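/- \textbf{Setting.} Let $\tilde\Omega\subset\mathbb R^2$ be a bounded open set with Lipschitz boundary, let $D$ be an open set with Lipschitz boundary and $\overline D\subset\tilde\Omega$, and put $\Omega=\tilde\Omega\setminus\overline D$ and $\Gamma_5=\partial D$. Let $\partial\tilde\Omega=\Gamma_1\cup\Gamma_2\cup\Gamma_3\cup\Gamma_4$ with measurable parts that are pairwise disjoint up to sets of length zero, where $\Gamma_3=\Gamma_2+p$ is a translate of $\Gamma_2$. Put $\Gamma=\Gamma_1\cup\dots\cup\Gamma_5=\partial\Omega$, and let $\vec n$ be the unit normal on $\Gamma$ pointing out of $\Omega$. Boundary values are traces, boundary integrals are with respect to arc length, $\Delta$ is the weak Laplacian, and normal derivatives of functions in $H^1(\Omega)$ with Laplacian in $L^2(\Omega)$ are defined by Green's formula: $\int_\Gamma\frac{\partial w}{\partial\vec n}\varphi\,ds=\int_\Omega(\nabla w\cdot\nabla\varphi+\Delta w\,\varphi)\,dx$ for all $\varphi\in C^\infty(\overline\Omega)$. Write $(f,g)_{X}=\Re\int_{X}f\bar g$. Let $k>0$, $A>0$, $\theta\in\mathbb R$, $u_{inc}(x)=A\exp(ik\,x\cdot(\cos\theta,\sin\theta))$,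 and $\alpha=i\,\frac{1-K}{1+K}$ with a real reflection coefficient $K\ne-1$. Let $u_0\in L^2(\Gamma_1)$ be complex-valued, and let $u\in H^1(\Omega)$, with $\frac{\partial u}{\partial\vec n}\in L^2(\Gamma)$, be a solution of the state problem $$-\Delta u-k^2u=0\ \text{on }\Omega,\qquad \tfrac{\partial u}{\partial\vec n}+k\alpha u=0\ \text{on }\Gamma_1,\Gamma_5,\qquad u|_{\Gamma_2}=u|_{\Gamma_3},\qquad \tfrac{\partial(u-u_{inc})}{\partial\vec n}-ik(u-u_{inc})=0\ \text{on }\Gamma_4,$$ where $u|_{\Gamma_2}=u|_{\Gamma_3}$ means $u(x)=u(x+p)$ for almost every $x\in\Gamma_2$. For $v\in H^1(\Omega)$ and $v_1\in L^2(\Gamma_1\cup\Gamma_5)$, $v_2\in L^2(\Gamma_2\cup\Gamma_3)$, $v_3\in L^2(\Gamma_4)$ (for instance traces of $H^1(\Omega)$ functions) consider the Lagrangian, without variance and perimeter terms, $$\begin{aligned}\mathcal L(u,v,v_1,v_2,v_3)={}&\tfrac12(u-u_0,u-u_0)_{\Gamma_1}+(\nabla u,\nabla v)_{\Omega}-k^2(u,v)_{\Omega}-\big(\tfrac{\partial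 u}{\partial\vec n},v\big)_{\Gamma}-\big(\tfrac{\partial u}{\partial\vec n}+k\alpha u,v_1\big)_{\Gamma_1\cup\Gamma_5}\\&+(u,v_2)_{\Gamma_2}+(u,v_2)_{\Gamma_3}-\big(\tfrac{\partial(u-u_{inc})}{\partial\vec n}-ik(u-u_{inc}),v_3\big)_{\Gamma_4}.\end{aligned}$$ Call $v\in H^1(\Omega)$ an \emph{adjoint} at $u$ if, for some such $v_1,v_2,v_3$, one has $\frac{d}{d\epsilon}\mathcal L(u+\epsilon\tilde u,v,v_1,v_2,v_3)|_{\epsilon=0}=0$ for all $\tilde u\in C^\infty(\overline\Omega;\mathbb C)$. \textbf{Theorem (Adjoint).} A function $v\in H^1(\Omega)$ is an adjoint at $u$ if and only if $\Delta v\in L^2(\Omega)$, $v$ has a normal derivative in $L^2(\Gamma)$, and $$\begin{aligned}-\Delta v-k^2v&=0&&\text{on }\Omega,\\ \tfrac{\partial v}{\partial\vec n}&=-(u-u_0)+k\alpha v&&\text{on }\Gamma_1,\\ \tfrac{\partial v}{\partial\vec n}&=k\alpha v&&\text{on }\Gamma_5,\\ \tfrac{\partial v}{\partial\vec n}&=-ikv&&\text{on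 }\Gamma_4,\\ v&=0&&\text{on }\Gamma_2,\Gamma_3.\end{aligned}$$ -/

import Mathlib

open MeasureTheory Filter Topology
open scoped ContDiff ComplexConjugate ENNReal

noncomputable section

namespace Helmholtz

/-- The Euclidean plane. -/
abbrev Plane : Type := EuclideanSpace ℝ (Fin 2)

/-! ### Lipschitz domains, surface measure and outward normal -/

/-- Near each of its boundary points, `U` is, after a rigid motion, the set of points lying
strictly below the graph of a Lipschitz function. -/
def HasLipschitzBoundary (U : Set Plane) : Prop :=
  ∀ p ∈ frontier U, ∃ (R : Plane ≃ₗᵢ[ℝ] Plane) (g : ℝ → ℝ) (C : NNReal), LipschitzWith C g ∧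
    ∀ᶠ z in 𝓝 p, (z ∈ U ↔ (R (z - p)) 1 < g ((R (z - p)) 0))

/-- `ν` is the outward unit normal of `U` at `x`: to first order at `x`, the set `U` is the
half-plane `{y | ⟪y - x, ν⟫ < 0}`. There is at most one such `ν`, and on a Lipschitz boundary it
exists at almost every point. -/
def IsOutwardNormalAt (U : Set Plane) (x ν : Plane) : Prop :=
  ‖ν‖ = 1 ∧ ∀ ε : ℝ, 0 < ε → ∀ᶠ y in 𝓝 x,
    (inner ℝ (y - x) ν < -(ε * ‖y - x‖) → y ∈ U) ∧
    (ε * ‖y - x‖ < inner ℝ (y - x) ν → y ∉ U)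

open Classical in
/-- The outward unit normal field of `U` (zero at the points where there is no normal). -/
def outwardNormal (U : Set Plane) (x : Plane) : Plane :=
  if h : ∃ ν, IsOutwardNormalAt U x ν then h.choose else 0

/-- Arc length, the one-dimensional Hausdorff measure, on a subset `Γ` of a curve. -/
def arcLength (Γ : Set Plane) : Measure Plane :=
  (Measure.hausdorffMeasure 1 : Measure Plane).restrict Γ

/-- The geometric setting: `Ω̃` (`tank`), the obstacle `D` compactly contained in it, and the
decomposition of `∂Ω̃` into the coast `Γ₁`, the lateral sides `Γ₂`, `Γ₃` (which are translates of
each other, so that periodic conditions make sense) and the open sea `Γ₄`. The four parts may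
share end points. -/
structure Configuration where
  tank : Set Plane
  obstacle : Set Plane
  Γ₁ : Set Plane
  Γ₂ : Set Plane
  Γ₃ : Set Plane
  Γ₄ : Set Plane
  period : Plane
  isOpen_tank : IsOpen tank
  isBounded_tank : Bornology.IsBounded tank
  lipschitz_tank : HasLipschitzBoundary tank
  isOpen_obstacle : IsOpen obstacle
  lipschitz_obstacle : HasLipschitzBoundary obstacle
  closure_obstacle_subset : closure obstacle ⊆ tank
  union_eq : Γ₁ ∪ Γ₂ ∪ Γ₃ ∪ Γ₄ = frontier tank
  measurable₁ : MeasurableSet Γ₁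
  measurable₂ : MeasurableSet Γ₂
  measurable₃ : MeasurableSet Γ₃
  measurable₄ : MeasurableSet Γ₄
  disjoint₁₂ : AEDisjoint (Measure.hausdorffMeasure 1) Γ₁ Γ₂
  disjoint₁₃ : AEDisjoint (Measure.hausdorffMeasure 1) Γ₁ Γ₃
  disjoint₁₄ : AEDisjoint (Measure.hausdorffMeasure 1) Γ₁ Γ₄
  disjoint₂₃ : AEDisjoint (Measure.hausdorffMeasure 1) Γ₂ Γ₃
  disjoint₂₄ : AEDisjoint (Measure.hausdorffMeasure 1) Γ₂ Γ₄
  disjoint₃₄ : AEDisjoint (Measure.hausdorffMeasure 1) Γ₃ Γ₄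
  translate : Γ₃ = (fun x => x + period) '' Γ₂

/-- The water domain: `Ω̃` without the closed obstacle. -/
def Configuration.Ω (S : Configuration) : Set Plane := S.tank \ closure S.obstacle

/-- The boundary of the obstacle. -/
def Configuration.Γ₅ (S : Configuration) : Set Plane := frontier S.obstacle

/-- The whole boundary `Γ` of `Ω`. -/
def Configuration.Γ (S : Configuration) : Set Plane :=
  S.Γ₁ ∪ S.Γ₂ ∪ S.Γ₃ ∪ S.Γ₄ ∪ S.Γ₅

/-- The outward unit normal of `Ω`. -/
def Configuration.normal (S : Configuration) : Plane → Plane := outwardNormal S.Ω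

/-! ### Sobolev functions, traces, weak Laplacian, weak normal derivative -/

/-- Smooth complex functions with compact support in the plane. Their restrictions to the closure
of a bounded set are the functions that are smooth up to the boundary. -/
def IsTest (φ : Plane → ℂ) : Prop := ContDiff ℝ ∞ φ ∧ HasCompactSupport φ

/-- The classical partial derivative of `φ` in the direction of the `i`-th coordinate. -/
def pderiv (i : Fin 2) (φ : Plane → ℂ) (x : Plane) : ℂ :=
  fderiv ℝ φ x (EuclideanSpace.single i 1)

/-- `f ∈ H¹(U)`, with weak partial derivatives `G 0`, `G 1`. -/
def IsH1 (U : Set Plane) (f : Plane → ℂ) (G : Fin 2 → Plane → ℂ) : Prop :=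
  MemLp f 2 (volume.restrict U) ∧ (∀ i, MemLp (G i) 2 (volume.restrict U)) ∧
    ∀ φ, IsTest φ → tsupport φ ⊆ U → ∀ i,
      ∫ x in U, f x * pderiv i φ x = -∫ x in U, G i x * φ x

/-- `t` is the trace on `Γ` of the `H¹(U)` function `f` with weak gradient `G`: the `L²(Γ)` limit
of the boundary values of smooth functions that converge to `f` in `H¹(U)`. -/
def IsTrace (U Γ : Set Plane) (f : Plane → ℂ) (G : Fin 2 → Plane → ℂ) (t : Plane → ℂ) : Prop :=
  MemLp t 2 (arcLength Γ) ∧ ∃ φ : ℕ → Plane → ℂ, (∀ n, IsTest (φ n)) ∧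
    Tendsto (fun n => eLpNorm (fun x => φ n x - f x) 2 (volume.restrict U)) atTop (𝓝 0) ∧
    (∀ i, Tendsto (fun n => eLpNorm (fun x => pderiv i (φ n) x - G i x) 2 (volume.restrict U))
      atTop (𝓝 0)) ∧
    Tendsto (fun n => eLpNorm (fun x => φ n x - t x) 2 (arcLength Γ)) atTop (𝓝 0)

/-- `ℓ` is the weak Laplacian in `U` of a function with weak gradient `G`. -/
def IsWeakLaplacian (U : Set Plane) (G : Fin 2 → Plane → ℂ) (ℓ : Plane → ℂ) : Prop :=
  MemLp ℓ 2 (volume.restrict U) ∧ ∀ φ, IsTest φ → tsupport φ ⊆ U →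
    ∫ x in U, ∑ i, G i x * pderiv i φ x = -∫ x in U, ℓ x * φ x

/-- `d ∈ L²(Γ)` is the outward normal derivative on `Γ = ∂U` of a function with weak gradient `G`
and weak Laplacian `ℓ`, in the usual sense for `H¹` functions whose Laplacian is in `L²`. -/
def IsNormalDeriv (U Γ : Set Plane) (G : Fin 2 → Plane → ℂ) (ℓ d : Plane → ℂ) : Prop :=
  MemLp d 2 (arcLength Γ) ∧ ∀ φ, IsTest φ →
    (∫ x in U, ∑ i, G i x * pderiv i φ x) + ∫ x in U, ℓ x * φ x
      = ∫ x, d x * φ x ∂(arcLength Γ)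

/-- The classical outward normal derivative on the boundary of `Ω` of a differentiable function. -/
def Configuration.dn (S : Configuration) (φ : Plane → ℂ) (x : Plane) : ℂ :=
  fderiv ℝ φ x (S.normal x)

/-- A function together with its weak gradient and its trace. -/
structure TracedField where
  fn : Plane → ℂ
  grad : Fin 2 → Plane → ℂ
  trace : Plane → ℂ

/-- A function together with its weak gradient, its trace and its normal derivative. -/
structure CauchyField extends TracedField where
  normalDeriv : Plane → ℂ

/-- `v` is an `H¹(Ω)` function with its weak gradient and its trace on `Γ`. -/
def Configuration.MemH1 (S : Configuration) (v : TracedField) : Prop :=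
  IsH1 S.Ω v.fn v.grad ∧ IsTrace S.Ω S.Γ v.fn v.grad v.trace

/-- The perturbation `u + ε φ` of `u` in the direction of a smooth `φ`. -/
def Configuration.perturb (S : Configuration) (u : CauchyField) (ε : ℝ) (φ : Plane → ℂ) :
    CauchyField where
  fn := fun x => u.fn x + ε * φ x
  grad := fun i x => u.grad i x + ε * pderiv i φ x
  trace := fun x => u.trace x + ε * φ x
  normalDeriv := fun x => u.normalDeriv x + ε * S.dn φ x

/-! ### The state problem -/

/-- The transmission coefficient `α = α₀ + i α₁` with `α₀ = 0` and `α₁ = (1 - K) / (1 + K)`. -/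
def alpha (K : ℝ) : ℂ := ⟨0, (1 - K) / (1 + K)⟩

/-- The incoming plane wave `A exp (i k x · (cos θ, sin θ))`. -/
def incoming (k A θ : ℝ) (x : Plane) : ℂ :=
  A * Complex.exp (Complex.I * k * ((x 0 * Real.cos θ + x 1 * Real.sin θ : ℝ) : ℂ))

/-- `u` is an `H¹(Ω)` solution, with a normal derivative in `L²(Γ)`, of the state problem. -/
structure IsStateSolution (S : Configuration) (k A θ K : ℝ) (u : CauchyField) : Prop where
  memH1 : S.MemH1 u.toTracedField
  helmholtz : IsWeakLaplacian S.Ω u.grad (fun x => -((k : ℂ) ^ 2 * u.fn x))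
  normalDeriv : IsNormalDeriv S.Ω S.Γ u.grad (fun x => -((k : ℂ) ^ 2 * u.fn x)) u.normalDeriv
  absorbing : ∀ᵐ x ∂(arcLength (S.Γ₁ ∪ S.Γ₅)), u.normalDeriv x + k * alpha K * u.trace x = 0
  periodic : ∀ᵐ x ∂(arcLength S.Γ₂), u.trace x = u.trace (x + S.period)
  sommerfeld : ∀ᵐ x ∂(arcLength S.Γ₄),
    (u.normalDeriv x - S.dn (incoming k A θ) x)
      - Complex.I * k * (u.trace x - incoming k A θ x) = 0

/-! ### The Lagrangian and its adjoint -/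

/-- The real inner product `(f, g) = Re ∫ f ḡ dμ` on complex functions. -/
def innerRe (μ : Measure Plane) (f g : Plane → ℂ) : ℝ := (∫ x, f x * conj (g x) ∂μ).re

/-- The tracking objective on the coast, as a functional of the boundary values of the state. -/
def objective (S : Configuration) (u₀ : Plane → ℂ) (u : CauchyField) : ℝ :=
  1 / 2 * innerRe (arcLength S.Γ₁) (fun x => u.trace x - u₀ x) (fun x => u.trace x - u₀ x)

/-- The Lagrangian of the tracking objective, with multipliers `v`, `v₁`, `v₂`, `v₃` for the
Helmholtz equation and the absorbing, lateral and radiation conditions. -/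
def lagrangian (S : Configuration) (k A θ K : ℝ) (u₀ : Plane → ℂ) (u : CauchyField)
    (v : TracedField) (v₁ v₂ v₃ : Plane → ℂ) : ℝ :=
  objective S u₀ u
    + ∑ i, innerRe (volume.restrict S.Ω) (u.grad i) (v.grad i)
    - k ^ 2 * innerRe (volume.restrict S.Ω) u.fn v.fn
    - innerRe (arcLength S.Γ) u.normalDeriv v.trace
    - innerRe (arcLength (S.Γ₁ ∪ S.Γ₅)) (fun x => u.normalDeriv x + k * alpha K * u.trace x) v₁
    + innerRe (arcLength S.Γ₂) u.trace v₂
    + innerRe (arcLength S.Γ₃) u.trace v₂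
    - innerRe (arcLength S.Γ₄)
        (fun x => (u.normalDeriv x - S.dn (incoming k A θ) x)
          - Complex.I * k * (u.trace x - incoming k A θ x)) v₃

/-- `v` is an adjoint at the state `u`: for suitable boundary multipliers, all the directional
derivatives of the Lagrangian with respect to `u` vanish at `u`. -/
def IsAdjoint (S : Configuration) (k A θ K : ℝ) (u₀ : Plane → ℂ) (u : CauchyField)
    (v : TracedField) : Prop :=
  ∃ v₁ v₂ v₃ : Plane → ℂ, MemLp v₁ 2 (arcLength (S.Γ₁ ∪ S.Γ₅)) ∧
    MemLp v₂ 2 (arcLength (S.Γ₂ ∪ S.Γ₃)) ∧ MemLp v₃ 2 (arcLength S.Γ₄) ∧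
    ∀ φ, IsTest φ →
      HasDerivAt (fun ε : ℝ => lagrangian S k A θ K u₀ (S.perturb u ε φ) v v₁ v₂ v₃) 0 0

/-- `v` solves the adjoint boundary value problem in strong form; `d` is its normal derivative. -/
def SolvesAdjointProblem (S : Configuration) (k K : ℝ) (u₀ : Plane → ℂ) (u : CauchyField)
    (v : TracedField) : Prop :=
  IsWeakLaplacian S.Ω v.grad (fun x => -((k : ℂ) ^ 2 * v.fn x)) ∧
  ∃ d : Plane → ℂ,
    IsNormalDeriv S.Ω S.Γ v.grad (fun x => -((k : ℂ) ^ 2 * v.fn x)) d ∧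
    (∀ᵐ x ∂(arcLength S.Γ₁), d x = -(u.trace x - u₀ x) + k * alpha K * v.trace x) ∧
    (∀ᵐ x ∂(arcLength S.Γ₅), d x = k * alpha K * v.trace x) ∧
    (∀ᵐ x ∂(arcLength S.Γ₄), d x = -(Complex.I * k * v.trace x)) ∧
    (∀ᵐ x ∂(arcLength (S.Γ₂ ∪ S.Γ₃)), v.trace x = 0)

end Helmholtz

end

noncomputable section

namespace Helmholtz

/-! ### Graph charts -/

/-- The `i`-th coordinate of a rotated vector, as a continuous linear functional. -/
def rotCoord (R : Plane ≃ₗᵢ[ℝ] Plane) (i : Fin 2) : Plane →L[ℝ] ℝ :=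
  (EuclideanSpace.proj i : Plane →L[ℝ] ℝ).comp
    (R.toContinuousLinearEquiv : Plane →L[ℝ] Plane)

theorem rotCoord_apply (R : Plane ≃ₗᵢ[ℝ] Plane) (i : Fin 2) (x : Plane) :
    rotCoord R i x = (R x) i := rfl

theorem inner_eq_rotCoord (R : Plane ≃ₗᵢ[ℝ] Plane) (x y : Plane) :
    inner ℝ x y = rotCoord R 0 x * rotCoord R 0 y + rotCoord R 1 x * rotCoord R 1 y := by
  rw [← R.inner_map_map x y, PiLp.inner_apply, Fin.sum_univ_two]
  simp only [rotCoord_apply, RCLike.inner_apply, conj_trivial, mul_comm]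

theorem abs_rotCoord_le (R : Plane ≃ₗᵢ[ℝ] Plane) (i : Fin 2) (x : Plane) :
    |rotCoord R i x| ≤ ‖x‖ := by
  rw [rotCoord_apply, ← R.norm_map x]
  exact PiLp.norm_apply_le (R x) i

theorem norm_rotCoord_le (R : Plane ≃ₗᵢ[ℝ] Plane) (i : Fin 2) : ‖rotCoord R i‖ ≤ 1 :=
  ContinuousLinearMap.opNorm_le_bound _ zero_le_one fun x => by
    simpa using abs_rotCoord_le R i x

/-- The vector with prescribed rotated coordinates. -/
def rotVec (R : Plane ≃ₗᵢ[ℝ] Plane) (a b : ℝ) : Plane := R.symm !₂[a, b]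

@[simp] theorem rotCoord_zero_rotVec (R : Plane ≃ₗᵢ[ℝ] Plane) (a b : ℝ) :
    rotCoord R 0 (rotVec R a b) = a := by simp [rotCoord_apply, rotVec]

@[simp] theorem rotCoord_one_rotVec (R : Plane ≃ₗᵢ[ℝ] Plane) (a b : ℝ) :
    rotCoord R 1 (rotVec R a b) = b := by simp [rotCoord_apply, rotVec]

theorem rotVec_rotCoord (R : Plane ≃ₗᵢ[ℝ] Plane) (x : Plane) :
    rotVec R (rotCoord R 0 x) (rotCoord R 1 x) = x := by
  apply R.injective
  ext i
  fin_cases i <;> simp [rotCoord_apply, rotVec]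

theorem continuous_rotVec (R : Plane ≃ₗᵢ[ℝ] Plane) :
    Continuous fun q : ℝ × ℝ => rotVec R q.1 q.2 := by
  unfold rotVec
  fun_prop

theorem rotCoord_trans_neg (R : Plane ≃ₗᵢ[ℝ] Plane) (i : Fin 2) (x : Plane) :
    rotCoord (R.trans (LinearIsometryEquiv.neg ℝ)) i x = -rotCoord R i x := by
  simp [rotCoord_apply]

/-- On the open set `V`, the set `U` lies strictly below the graph of the Lipschitz function `g`
in the coordinates centred at `p` and rotated by `R`. -/
structure IsGraphChart (U V : Set Plane) (p : Plane) (R : Plane ≃ₗᵢ[ℝ] Plane) (g : ℝ → ℝ)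
    (C : NNReal) : Prop where
  isOpen : IsOpen V
  lipschitz : LipschitzWith C g
  mem_iff : ∀ z ∈ V, z ∈ U ↔ rotCoord R 1 (z - p) < g (rotCoord R 0 (z - p))

theorem HasLipschitzBoundary.exists_chart {U : Set Plane} (hU : HasLipschitzBoundary U)
    {p : Plane} (hp : p ∈ frontier U) :
    ∃ V R g C, p ∈ V ∧ IsGraphChart U V p R g C := by
  obtain ⟨R, g, C, hg, h⟩ := hU p hp
  obtain ⟨V, hV, hVo, hpV⟩ := eventually_nhds_iff.1 h
  exact ⟨V, R, g, C, hpV, hVo, hg, hV⟩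

namespace IsGraphChart

variable {U V W : Set Plane} {p : Plane} {R : Plane ≃ₗᵢ[ℝ] Plane} {g : ℝ → ℝ} {C : NNReal}

theorem mem_closure_iff (h : IsGraphChart U V p R g C) {z : Plane} (hz : z ∈ V) :
    z ∈ closure U ↔ rotCoord R 1 (z - p) ≤ g (rotCoord R 0 (z - p)) := by
  have hgc := h.lipschitz.continuous
  constructor
  · intro hcl
    by_contra! hlt
    have ho : IsOpen {y | g (rotCoord R 0 (y - p)) < rotCoord R 1 (y - p)} :=
      isOpen_lt (by fun_prop) (by fun_prop)
    obtain ⟨y, ⟨hy, hyV⟩, hyU⟩ := _root_.mem_closure_iff.1 hcl _ (ho.inter h.isOpen) ⟨hlt, hz⟩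
    exact lt_asymm hy ((h.mem_iff y hyV).1 hyU)
  · intro hle
    have hc : Continuous fun s : ℝ => z - rotVec R 0 s :=
      continuous_const.sub ((continuous_rotVec R).comp (by fun_prop : Continuous fun s : ℝ =>
        ((0 : ℝ), s)))
    have h0 : rotVec R 0 0 = 0 := by
      have := rotVec_rotCoord R 0
      simpa using this
    have ht : Tendsto (fun s : ℝ => z - rotVec R 0 s) (𝓝[>] 0) (𝓝 z) := by
      have := (hc.tendsto 0).mono_left (nhdsWithin_le_nhds (s := Set.Ioi 0))
      simpa [h0] using this
    refine mem_closure_of_tendsto ht ?_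
    filter_upwards [ht (h.isOpen.mem_nhds hz), self_mem_nhdsWithin] with s hs hs0
    refine (h.mem_iff _ hs).2 ?_
    have e : z - rotVec R 0 s - p = (z - p) - rotVec R 0 s := by abel
    rw [e, map_sub _ (z - p), map_sub _ (z - p), rotCoord_zero_rotVec, rotCoord_one_rotVec,
      sub_zero]
    have : (0 : ℝ) < s := hs0
    linarith

theorem eq_of_mem_frontier (h : IsGraphChart U V p R g C) (hU : IsOpen U) {z : Plane}
    (hz : z ∈ V) (hf : z ∈ frontier U) :
    rotCoord R 1 (z - p) = g (rotCoord R 0 (z - p)) := by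
  rw [hU.frontier_eq] at hf
  exact le_antisymm ((h.mem_closure_iff hz).1 hf.1) (not_lt.1 fun hlt => hf.2 ((h.mem_iff z hz).2 hlt))

theorem congr (h : IsGraphChart U V p R g C) (hW : IsOpen W) {U' : Set Plane}
    (hWU : ∀ z ∈ W, z ∈ U' ↔ z ∈ U) : IsGraphChart U' (V ∩ W) p R g C :=
  ⟨h.isOpen.inter hW, h.lipschitz, fun z hz => (hWU z hz.2).trans (h.mem_iff z hz.1)⟩

theorem compl_closure (h : IsGraphChart U V p R g C) :
    IsGraphChart (closure U)ᶜ V p (R.trans (LinearIsometryEquiv.neg ℝ)) (fun t => -g (-t)) C := by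
  refine ⟨h.isOpen, ?_, fun z hz => ?_⟩
  · refine LipschitzWith.of_dist_le_mul fun x y => ?_
    have := h.lipschitz.dist_le_mul (-x) (-y)
    simpa [dist_neg_neg] using this
  · have e : ∀ i, rotCoord (R.trans (LinearIsometryEquiv.neg ℝ)) i (z - p)
        = -rotCoord R i (z - p) := fun i => rotCoord_trans_neg R i _
    rw [Set.mem_compl_iff, h.mem_closure_iff hz, e, e, neg_neg, not_le, neg_lt_neg_iff]

end IsGraphChart

theorem IsOutwardNormalAt.unique {U : Set Plane} {x ν ν' : Plane} (h : IsOutwardNormalAt U x ν)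
    (h' : IsOutwardNormalAt U x ν') : ν = ν' := by
  by_contra hne
  have hlt : inner ℝ ν ν' < 1 :=
    (inner_lt_one_iff_real_of_norm_eq_one h.1 h'.1).2 hne
  set e : Plane := ν' - ν
  have he : inner ℝ e ν = inner ℝ ν ν' - 1 := by
    simp [e, inner_sub_left, h.1, real_inner_comm]
  have he' : inner ℝ e ν' = 1 - inner ℝ ν ν' := by
    simp [e, inner_sub_left, h'.1]
  have hpos : 0 < ‖e‖ := norm_pos_iff.2 (sub_ne_zero.2 (Ne.symm hne))
  set ε := (1 - inner ℝ ν ν') / (2 * ‖e‖) with hε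
  have hε0 : 0 < ε := div_pos (by linarith) (by positivity)
  have hεe : ε * ‖e‖ = (1 - inner ℝ ν ν') / 2 := by rw [hε]; field_simp
  have ht : Tendsto (fun s : ℝ => x + s • e) (𝓝[>] 0) (𝓝 x) := by
    have : Continuous fun s : ℝ => x + s • e := by fun_prop
    have := (this.tendsto 0).mono_left (nhdsWithin_le_nhds (s := Set.Ioi 0))
    simpa using this
  obtain ⟨s, h1, h2, hs⟩ :=
    ((ht.eventually (h.2 ε hε0)).and ((ht.eventually (h'.2 ε hε0)).and self_mem_nhdsWithin)).exists
  have hs' : (0 : ℝ) < s := hs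
  have hn : ε * ‖s • e‖ = s * ((1 - inner ℝ ν ν') / 2) := by
    rw [norm_smul, Real.norm_of_nonneg hs'.le, ← hεe]; ring
  simp only [add_sub_cancel_left, inner_smul_left, hn, he, he'] at h1 h2
  simp only [conj_trivial] at h1 h2
  exact h2.2 (by nlinarith) (h1.1 (by nlinarith))

theorem IsOutwardNormalAt.outwardNormal_eq {U : Set Plane} {x ν : Plane}
    (h : IsOutwardNormalAt U x ν) : outwardNormal U x = ν := by
  have hex : ∃ ν, IsOutwardNormalAt U x ν := ⟨ν, h⟩
  rw [outwardNormal, dif_pos hex]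
  exact hex.choose_spec.unique h

/-- The length of the normal `(-s, 1)` of a graph with slope `s`. -/
def slopeNorm (s : ℝ) : ℝ := Real.sqrt (1 + s ^ 2)

theorem one_le_slopeNorm (s : ℝ) : 1 ≤ slopeNorm s :=
  Real.one_le_sqrt.2 (by nlinarith [sq_nonneg s])

theorem slopeNorm_mul_self (s : ℝ) : slopeNorm s * slopeNorm s = 1 + s ^ 2 :=
  Real.mul_self_sqrt (by positivity)

/-- The unit normal to a graph with slope `s`. -/
def graphNormal (R : Plane ≃ₗᵢ[ℝ] Plane) (s : ℝ) : Plane :=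
  rotVec R (-s / slopeNorm s) (1 / slopeNorm s)

theorem measurable_graphNormal (R : Plane ≃ₗᵢ[ℝ] Plane) : Measurable (graphNormal R) := by
  unfold graphNormal
  refine (continuous_rotVec R).measurable.comp (Measurable.prodMk ?_ ?_) <;>
  · unfold slopeNorm
    fun_prop

theorem IsGraphChart.isOutwardNormalAt {U V : Set Plane} {p : Plane} {R : Plane ≃ₗᵢ[ℝ] Plane}
    {g : ℝ → ℝ} {C : NNReal} (h : IsGraphChart U V p R g C) {x : Plane} (hx : x ∈ V)
    (hxg : rotCoord R 1 (x - p) = g (rotCoord R 0 (x - p)))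
    (hd : DifferentiableAt ℝ g (rotCoord R 0 (x - p))) :
    IsOutwardNormalAt U x (graphNormal R (deriv g (rotCoord R 0 (x - p)))) := by
  set t := rotCoord R 0 (x - p) with ht
  set s := deriv g t with hs
  have hm1 := one_le_slopeNorm s
  have hm0 : 0 < slopeNorm s := by linarith
  constructor
  · have : inner ℝ (graphNormal R s) (graphNormal R s) = (1 : ℝ) := by
      rw [inner_eq_rotCoord R]
      simp only [graphNormal, rotCoord_zero_rotVec, rotCoord_one_rotVec]
      field_simp
      rw [pow_two (slopeNorm s), slopeNorm_mul_self]; ring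
    rw [real_inner_self_eq_norm_sq] at this
    nlinarith [norm_nonneg (graphNormal R s)]
  · intro ε hε
    have hlin := (hasDerivAt_iff_isLittleO.1 hd.hasDerivAt).def hε
    have hc : Tendsto (fun y : Plane => rotCoord R 0 (y - p)) (𝓝 x) (𝓝 t) := by
      have : Continuous fun y : Plane => rotCoord R 0 (y - p) := by fun_prop
      exact this.tendsto x
    filter_upwards [hc.eventually hlin, h.isOpen.mem_nhds hx] with y hy hyV
    rw [h.mem_iff y hyV]
    have e : ∀ i, rotCoord R i (y - p) = rotCoord R i (x - p) + rotCoord R i (y - x) := fun i => by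
      rw [← map_add]; congr 1; abel
    have hi : inner ℝ (y - x) (graphNormal R s)
        = (rotCoord R 1 (y - x) - s * rotCoord R 0 (y - x)) / slopeNorm s := by
      rw [inner_eq_rotCoord R]
      simp only [graphNormal, rotCoord_zero_rotVec, rotCoord_one_rotVec]
      ring
    have hb := abs_rotCoord_le R 0 (y - x)
    have e0 := e 0
    rw [← ht] at e0
    have hsub : rotCoord R 0 (y - p) - t = rotCoord R 0 (y - x) := by rw [e0]; ring
    rw [hsub, ← hs, smul_eq_mul, Real.norm_eq_abs, Real.norm_eq_abs] at hy
    have hy1 : ε * |rotCoord R 0 (y - x)| ≤ ε * ‖y - x‖ := by gcongr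
    have hy2 : ε * ‖y - x‖ ≤ ε * ‖y - x‖ * slopeNorm s :=
      le_mul_of_one_le_right (by positivity) hm1
    have hab := abs_le.1 (hy.trans hy1)
    rw [hi, e 1, hxg]
    constructor
    · intro hlt
      rw [div_lt_iff₀ hm0] at hlt
      linarith [hab.1]
    · intro hlt
      rw [lt_div_iff₀ hm0] at hlt
      rw [not_lt]
      linarith [hab.2]

/-! ### Arc length on a graph -/

/-- The parametrization of the graph of `g`. -/
def graphParam (p : Plane) (R : Plane ≃ₗᵢ[ℝ] Plane) (g : ℝ → ℝ) (t : ℝ) : Plane :=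
  p + rotVec R t (g t)

theorem lipschitzWith_graphParam (p : Plane) (R : Plane ≃ₗᵢ[ℝ] Plane) {g : ℝ → ℝ} {C : NNReal}
    (hg : LipschitzWith C g) : LipschitzWith (1 + C) (graphParam p R g) := by
  refine LipschitzWith.of_dist_le_mul fun s t => ?_
  have hd := hg.dist_le_mul s t
  have e : graphParam p R g s - graphParam p R g t = R.symm !₂[s - t, g s - g t] := by
    simp only [graphParam, rotVec, add_sub_add_left_eq_sub, ← map_sub]
    congr 1
    ext i; fin_cases i <;> simp
  rw [dist_eq_norm, e, R.symm.norm_map, EuclideanSpace.norm_eq, Fin.sum_univ_two]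
  rw [Real.dist_eq, Real.dist_eq] at hd
  refine Real.sqrt_le_iff.2 ⟨by positivity, ?_⟩
  simp only [Real.norm_eq_abs, Matrix.cons_val_zero, Matrix.cons_val_one,
    Real.dist_eq]
  push_cast
  have h0 := abs_nonneg (s - t)
  have h1 := abs_nonneg (g s - g t)
  have hC : (0 : ℝ) ≤ C := C.2
  nlinarith [mul_nonneg hC h0, mul_nonneg h0 (mul_nonneg hC h0)]

theorem graphParam_rotCoord {p : Plane} {R : Plane ≃ₗᵢ[ℝ] Plane} {g : ℝ → ℝ} {z : Plane}
    (hz : rotCoord R 1 (z - p) = g (rotCoord R 0 (z - p))) :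
    graphParam p R g (rotCoord R 0 (z - p)) = z := by
  rw [graphParam, ← hz, rotVec_rotCoord]; abel

theorem hausdorffMeasure_graph_lt_top {p : Plane} {R : Plane ≃ₗᵢ[ℝ] Plane} {g : ℝ → ℝ}
    {C : NNReal} (hg : LipschitzWith C g) {s : Set Plane} (hb : Bornology.IsBounded s)
    (hs : ∀ z ∈ s, rotCoord R 1 (z - p) = g (rotCoord R 0 (z - p))) :
    (Measure.hausdorffMeasure 1 : Measure Plane) s < ⊤ := by
  obtain ⟨r, hr⟩ := hb.subset_closedBall p
  have hsub : s ⊆ graphParam p R g '' Set.Icc (-r) r := fun z hz => by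
    refine ⟨rotCoord R 0 (z - p), abs_le.1 ((abs_rotCoord_le R 0 _).trans ?_),
      graphParam_rotCoord (hs z hz)⟩
    exact mem_closedBall_iff_norm.1 (hr hz)
  refine (measure_mono hsub).trans_lt
    (((lipschitzWith_graphParam p R hg).hausdorffMeasure_image_le zero_le_one _).trans_lt ?_)
  rw [hausdorffMeasure_real, Real.volume_Icc]
  exact ENNReal.mul_lt_top (by simp) ENNReal.ofReal_lt_top

theorem ae_arcLength_of_ae_graph {p : Plane} {R : Plane ≃ₗᵢ[ℝ] Plane} {g : ℝ → ℝ}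
    {C : NNReal} (hg : LipschitzWith C g) {s : Set Plane} (hsm : MeasurableSet s)
    (hs : ∀ z ∈ s, rotCoord R 1 (z - p) = g (rotCoord R 0 (z - p))) {P : ℝ → Prop}
    (hP : ∀ᵐ t, P t) : ∀ᵐ z ∂(arcLength s), P (rotCoord R 0 (z - p)) := by
  rw [arcLength, ae_restrict_iff' hsm]
  refine measure_mono_null (t := graphParam p R g '' {t | ¬ P t}) (fun z hz => ?_) ?_
  · have hz' : z ∈ s ∧ ¬ P (rotCoord R 0 (z - p)) := Classical.not_imp.1 hz
    exact ⟨_, hz'.2, graphParam_rotCoord (hs z hz'.1)⟩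
  · have := (lipschitzWith_graphParam p R hg).hausdorffMeasure_image_le zero_le_one {t | ¬ P t}
    rw [hausdorffMeasure_real, (ae_iff.1 hP : volume {t | ¬ P t} = 0), mul_zero] at this
    exact le_antisymm this zero_le

/-! ### The boundary of the water domain -/

namespace Configuration

variable (S : Configuration)

theorem Γ_eq : S.Γ = frontier S.tank ∪ frontier S.obstacle := by
  rw [Γ, S.union_eq, Γ₅]

theorem frontier_obstacle_subset : frontier S.obstacle ⊆ S.tank :=
  frontier_subset_closure.trans S.closure_obstacle_subset

theorem isOpen_Ω : IsOpen S.Ω := S.isOpen_tank.sdiff isClosed_closure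

theorem isBounded_Ω : Bornology.IsBounded S.Ω := S.isBounded_tank.subset Set.sdiff_subset

theorem isCompact_Γ : IsCompact S.Γ := by
  rw [Γ_eq]
  refine Metric.isCompact_of_isClosed_isBounded (isClosed_frontier.union isClosed_frontier) ?_
  exact (S.isBounded_tank.closure.subset frontier_subset_closure).union
    (S.isBounded_tank.subset S.frontier_obstacle_subset)

theorem disjoint_Γ_Ω : Disjoint S.Γ S.Ω := by
  rw [Γ_eq, Set.disjoint_left]
  rintro x (hx | hx) hΩ
  · rw [S.isOpen_tank.frontier_eq] at hx
    exact hx.2 hΩ.1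
  · exact hΩ.2 (frontier_subset_closure hx)

theorem exists_chart {p : Plane} (hp : p ∈ S.Γ) :
    ∃ V R g C, p ∈ V ∧ IsGraphChart S.Ω V p R g C ∧
      ∀ z ∈ V ∩ S.Γ, rotCoord R 1 (z - p) = g (rotCoord R 0 (z - p)) := by
  rw [Γ_eq] at hp
  rcases hp with hp | hp
  · obtain ⟨V, R, g, C, hpV, h⟩ := S.lipschitz_tank.exists_chart hp
    have hW : IsOpen (closure S.obstacle)ᶜ := isClosed_closure.isOpen_compl
    have hpW : p ∈ (closure S.obstacle)ᶜ := fun hc => by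
      rw [S.isOpen_tank.frontier_eq] at hp
      exact hp.2 (S.closure_obstacle_subset hc)
    refine ⟨V ∩ (closure S.obstacle)ᶜ, R, g, C, ⟨hpV, hpW⟩, h.congr hW fun z hz => ⟨fun h => h.1, fun h => ⟨h, hz⟩⟩, ?_⟩
    rintro z ⟨⟨hzV, hzW⟩, hz⟩
    rw [Γ_eq] at hz
    rcases hz with hz | hz
    · exact h.eq_of_mem_frontier S.isOpen_tank hzV hz
    · exact absurd (frontier_subset_closure hz) hzW
  · obtain ⟨V, R, g, C, hpV, h⟩ := S.lipschitz_obstacle.exists_chart hp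
    refine ⟨V ∩ S.tank, _, _, C, ⟨hpV, S.frontier_obstacle_subset hp⟩, h.compl_closure.congr S.isOpen_tank
      fun z hz => ⟨fun h => h.2, fun h => ⟨hz, h⟩⟩, ?_⟩
    rintro z ⟨⟨hzV, hzW⟩, hz⟩
    rw [Γ_eq] at hz
    rcases hz with hz | hz
    · rw [S.isOpen_tank.frontier_eq] at hz
      exact absurd hzW hz.2
    · have := h.eq_of_mem_frontier S.isOpen_obstacle hzV hz
      have e : ∀ i, rotCoord (R.trans (LinearIsometryEquiv.neg ℝ)) i (z - p)
          = -rotCoord R i (z - p) := fun i => rotCoord_trans_neg R i _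
      rw [e, e, this, neg_neg]

theorem measurableSet_Γ : MeasurableSet S.Γ := S.isCompact_Γ.isClosed.measurableSet

/-- In a chart, the outward normal is almost everywhere that of the graph. -/
theorem ae_normal_eq {V : Set Plane} {p : Plane} {R : Plane ≃ₗᵢ[ℝ] Plane} {g : ℝ → ℝ} {C : NNReal}
    (h : IsGraphChart S.Ω V p R g C)
    (hΓ : ∀ z ∈ V ∩ S.Γ, rotCoord R 1 (z - p) = g (rotCoord R 0 (z - p))) :
    ∀ᵐ x ∂(arcLength (V ∩ S.Γ)),
      S.normal x = graphNormal R (deriv g (rotCoord R 0 (x - p))) := by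
  have hm : MeasurableSet (V ∩ S.Γ) := h.isOpen.measurableSet.inter S.measurableSet_Γ
  have hae := ae_arcLength_of_ae_graph (p := p) (R := R) h.lipschitz hm hΓ
    h.lipschitz.ae_differentiableAt_real
  filter_upwards [hae, ae_restrict_mem hm] with x hx hxV
  exact (h.isOutwardNormalAt hxV.1 (hΓ x hxV) hx).outwardNormal_eq

theorem hausdorffMeasure_Γ_lt_top_and_aestronglyMeasurable_normal :
    (Measure.hausdorffMeasure 1 : Measure Plane) S.Γ < ⊤ ∧
    AEStronglyMeasurable S.normal (arcLength S.Γ) := by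
  refine S.isCompact_Γ.induction_on (p := fun s =>
    (Measure.hausdorffMeasure 1 : Measure Plane) s < ⊤ ∧
      AEStronglyMeasurable S.normal (arcLength s)) ?_ ?_ ?_ ?_
  · simp [arcLength]
  · intro s t hst ht
    exact ⟨(measure_mono hst).trans_lt ht.1, ht.2.mono_measure (Measure.restrict_mono_set _ hst)⟩
  · intro s t hs ht
    exact ⟨measure_union_lt_top hs.1 ht.1, aestronglyMeasurable_union_iff.2 ⟨hs.2, ht.2⟩⟩
  · intro x hx
    obtain ⟨V, R, g, C, hpV, h, hΓ⟩ := S.exists_chart hx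
    refine ⟨V ∩ S.Γ, Filter.inter_mem (mem_nhdsWithin_of_mem_nhds (h.isOpen.mem_nhds hpV)) self_mem_nhdsWithin, ?_, ?_⟩
    · exact hausdorffMeasure_graph_lt_top h.lipschitz
        (S.isCompact_Γ.isBounded.subset Set.inter_subset_right) hΓ
    · have hmeas : Measurable fun y : Plane => graphNormal R (deriv g (rotCoord R 0 (y - x))) :=
        (measurable_graphNormal R).comp ((measurable_deriv g).comp (by fun_prop))
      exact hmeas.aestronglyMeasurable.congr
        ((S.ae_normal_eq h hΓ).mono fun y hy => hy.symm)

instance isFiniteMeasure_arcLength_Γ : IsFiniteMeasure (arcLength S.Γ) :=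
  ⟨by
    rw [arcLength, Measure.restrict_apply_univ]
    exact S.hausdorffMeasure_Γ_lt_top_and_aestronglyMeasurable_normal.1⟩

instance isFiniteMeasure_volume_Ω : IsFiniteMeasure (volume.restrict S.Ω) :=
  ⟨by
    rw [Measure.restrict_apply_univ]
    exact S.isBounded_Ω.measure_lt_top⟩

theorem aestronglyMeasurable_normal : AEStronglyMeasurable S.normal (arcLength S.Γ) :=
  S.hausdorffMeasure_Γ_lt_top_and_aestronglyMeasurable_normal.2

theorem norm_normal_le (x : Plane) : ‖S.normal x‖ ≤ 1 := by
  unfold normal outwardNormal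
  split_ifs with h
  · exact h.choose_spec.1.le
  · simp

theorem norm_dn_le (φ : Plane → ℂ) (x : Plane) : ‖S.dn φ x‖ ≤ ‖fderiv ℝ φ x‖ :=
  (ContinuousLinearMap.le_opNorm _ _).trans
    (mul_le_of_le_one_right (norm_nonneg _) (S.norm_normal_le x))

theorem aestronglyMeasurable_dn {φ : Plane → ℂ} (hφ : ContDiff ℝ ∞ φ) :
    AEStronglyMeasurable (S.dn φ) (arcLength S.Γ) :=
  (isBoundedBilinearMap_apply (𝕜 := ℝ) (E := Plane) (F := ℂ)).continuous
    |>.comp_aestronglyMeasurable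
      ((hφ.continuous_fderiv (by simp)).aestronglyMeasurable.prodMk S.aestronglyMeasurable_normal)

end Configuration

/-! ### Mollification of Lipschitz functions -/

theorem hasDerivAt_normed_convolution_of_lipschitz (φ : ContDiffBump (0 : ℝ)) {g : ℝ → ℝ}
    {C : NNReal} (hg : LipschitzWith C g) (t : ℝ) :
    HasDerivAt (convolution (φ.normed volume) g (ContinuousLinearMap.lsmul ℝ ℝ) volume)
      (convolution (φ.normed volume) (deriv g) (ContinuousLinearMap.lsmul ℝ ℝ) volume t) t := by
  have hφc : Continuous (φ.normed volume) := φ.continuous_normed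
  have hgc := hg.continuous
  have hint : Integrable (φ.normed volume) := φ.integrable_normed
  refine (hasDerivAt_integral_of_dominated_loc_of_lip
    (F := fun t s => (ContinuousLinearMap.lsmul ℝ ℝ) (φ.normed volume s) (g (t - s)))
    (F' := fun s => (ContinuousLinearMap.lsmul ℝ ℝ) (φ.normed volume s) (deriv g (t - s)))
    (bound := fun s => φ.normed volume s * C) (s := Set.univ) univ_mem ?_ ?_ ?_ ?_ ?_ ?_).2
  · refine Eventually.of_forall fun x => Continuous.aestronglyMeasurable ?_
    simp only [ContinuousLinearMap.lsmul_apply, smul_eq_mul]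
    fun_prop
  · simp only [ContinuousLinearMap.lsmul_apply, smul_eq_mul]
    refine Continuous.integrable_of_hasCompactSupport (by fun_prop) ?_
    exact φ.hasCompactSupport_normed.mul_right
  · simp only [ContinuousLinearMap.lsmul_apply, smul_eq_mul]
    exact (hφc.measurable.mul ((measurable_deriv g).comp (by fun_prop))).aestronglyMeasurable
  · refine Eventually.of_forall fun s => LipschitzOnWith.of_dist_le_mul fun x _ y _ => ?_
    have h0 := φ.nonneg_normed s (μ := volume)
    have := hg.dist_le_mul (x - s) (y - s)
    rw [dist_sub_right, Real.dist_eq] at this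
    simp only [ContinuousLinearMap.lsmul_apply, smul_eq_mul, Real.dist_eq, ← mul_sub, abs_mul]
      at this ⊢
    rw [abs_of_nonneg h0, Real.coe_nnabs, abs_of_nonneg (mul_nonneg h0 C.coe_nonneg), mul_assoc]
    exact mul_le_mul_of_nonneg_left this h0
  · exact hint.mul_const _
  · have hq := (Measure.measurePreserving_sub_left (volume : Measure ℝ) t).quasiMeasurePreserving.ae
      hg.ae_differentiableAt_real
    filter_upwards [hq] with s hs
    have := (hs.hasDerivAt.comp t ((hasDerivAt_id t).sub_const s)).const_mul (φ.normed volume s)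
    simpa using this

theorem exists_smooth_approx_of_lipschitz {g : ℝ → ℝ} {C : NNReal} (hg : LipschitzWith C g)
    {ε : ℕ → ℝ} (hε : ∀ n, 0 < ε n) (hε0 : Tendsto ε atTop (𝓝 0)) :
    ∃ G : ℕ → ℝ → ℝ, (∀ n, ContDiff ℝ ∞ (G n)) ∧ (∀ n t, |G n t - g t| ≤ C * ε n) ∧
      (∀ n t, |deriv (G n) t| ≤ C) ∧
      ∀ᵐ t, Tendsto (fun n => deriv (G n) t) atTop (𝓝 (deriv g t)) := by
  let φ : ℕ → ContDiffBump (0 : ℝ) := fun n =>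
    ⟨ε n / 2, ε n, half_pos (hε n), half_lt_self (hε n)⟩
  have hgd : ∀ t, ‖deriv g t‖ ≤ C := fun t => norm_deriv_le_of_lipschitz hg
  have hli : LocallyIntegrable (deriv g) volume :=
    (locallyIntegrable_const (C : ℝ)).mono (measurable_deriv g).aestronglyMeasurable
      (Eventually.of_forall fun t => by simpa using hgd t)
  have hder := fun n t => (hasDerivAt_normed_convolution_of_lipschitz (φ n) hg t).deriv
  refine ⟨fun n => convolution ((φ n).normed volume) g (ContinuousLinearMap.lsmul ℝ ℝ) volume,
    fun n => ?_, fun n t => ?_, fun n t => ?_, ?_⟩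
  · exact (φ n).hasCompactSupport_normed.contDiff_convolution_left _ (φ n).contDiff_normed
      hg.continuous.locallyIntegrable
  · rw [← Real.dist_eq]
    refine ContDiffBump.dist_normed_convolution_le hg.continuous.aestronglyMeasurable fun x hx => ?_
    exact (hg.dist_le_mul x t).trans (mul_le_mul_of_nonneg_left (Metric.mem_ball.1 hx).le C.2)
  · rw [hder, ← Real.norm_eq_abs]
    refine (norm_integral_le_of_norm_le (((φ n).integrable_normed (μ := volume)).mul_const (C : ℝ))
      (Eventually.of_forall fun s => ?_)).trans ?_
    · simp only [ContinuousLinearMap.lsmul_apply, smul_eq_mul, norm_mul]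
      rw [Real.norm_of_nonneg ((φ n).nonneg_normed s)]
      exact mul_le_mul_of_nonneg_left (hgd _) ((φ n).nonneg_normed s)
    · rw [integral_mul_const, (φ n).integral_normed, one_mul]
  · simp only [hder]
    refine ContDiffBump.ae_convolution_tendsto_right_of_locallyIntegrable (K := 2) hε0 ?_ hli
    exact Eventually.of_forall fun n => by simp only [φ]; linarith

/-! ### Functions concentrating their normal derivative on a graph -/

theorem exists_profile : ∃ η : ℝ → ℝ, ContDiff ℝ ∞ η ∧ HasCompactSupport η ∧ deriv η 0 = 1 := by
  let β : ContDiffBump (0 : ℝ) := ⟨1, 2, one_pos, one_lt_two⟩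
  refine ⟨fun s => s * β s, contDiff_id.mul β.contDiff, β.hasCompactSupport.mul_left, ?_⟩
  have h : (fun s => s * β s) =ᶠ[𝓝 0] fun s => s := by
    filter_upwards [β.eventuallyEq_one] with s hs
    simp [hs]
  rw [h.deriv_eq]
  simp

theorem exists_radius_of_hasCompactSupport {η : ℝ → ℝ} (h : HasCompactSupport η) :
    ∃ r, ∀ s, r < |s| → η s = 0 ∧ deriv η s = 0 := by
  obtain ⟨r, hr⟩ := h.isCompact.isBounded.subset_closedBall 0
  refine ⟨r, fun s hs => ?_⟩
  have hn : s ∉ tsupport η := fun hm => by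
    have := mem_closedBall_zero_iff.1 (hr hm)
    rw [Real.norm_eq_abs] at this
    linarith
  exact ⟨image_eq_zero_of_notMem_tsupport hn,
    image_eq_zero_of_notMem_tsupport fun hm => hn (tsupport_deriv_subset hm)⟩

/-- Functions tending to zero uniformly with bounded gradients, whose gradients tend to zero off
the boundary, while their normal derivatives tend to a positive multiple of `ψ`. -/
theorem Configuration.exists_normal_concentration (S : Configuration) {V : Set Plane} {p : Plane}
    {R : Plane ≃ₗᵢ[ℝ] Plane} {g : ℝ → ℝ} {C : NNReal} (h : IsGraphChart S.Ω V p R g C)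
    (hΓ : ∀ z ∈ V ∩ S.Γ, rotCoord R 1 (z - p) = g (rotCoord R 0 (z - p)))
    {ψ : Plane → ℝ} (hψ : ContDiff ℝ ∞ ψ) (hψc : HasCompactSupport ψ) (hψV : tsupport ψ ⊆ V) :
    ∃ (φ : ℕ → Plane → ℂ) (M : ℝ), (∀ n, IsTest (φ n)) ∧ (∀ n x, ‖φ n x‖ ≤ M) ∧
      (∀ n x, ‖fderiv ℝ (φ n) x‖ ≤ M) ∧ (∀ x, Tendsto (fun n => φ n x) atTop (𝓝 0)) ∧
      (∀ x ∈ S.Ω, Tendsto (fun n => fderiv ℝ (φ n) x) atTop (𝓝 0)) ∧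
      ∀ᵐ x ∂(arcLength S.Γ), Tendsto (fun n => S.dn (φ n) x) atTop
        (𝓝 ((ψ x * slopeNorm (deriv g (rotCoord R 0 (x - p))) : ℝ) : ℂ)) := by
  obtain ⟨η, hη, hηc, hη1⟩ := exists_profile
  obtain ⟨r, hr⟩ := exists_radius_of_hasCompactSupport hηc
  have hη' : Continuous (deriv η) := hη.continuous_deriv (by simp)
  obtain ⟨M₀, hM₀⟩ := hηc.exists_bound_of_continuous hη.continuous
  obtain ⟨M₁, hM₁⟩ := hηc.deriv.exists_bound_of_continuous hη'
  obtain ⟨N₀, hN₀⟩ := hψc.exists_bound_of_continuous hψ.continuous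
  obtain ⟨N₁, hN₁⟩ := (hψc.fderiv (𝕜 := ℝ)).exists_bound_of_continuous
    (hψ.continuous_fderiv (by simp))
  have hM₀0 : 0 ≤ M₀ := (norm_nonneg _).trans (hM₀ 0)
  have hM₁0 : 0 ≤ M₁ := (norm_nonneg _).trans (hM₁ 0)
  have hN₀0 : 0 ≤ N₀ := (norm_nonneg _).trans (hN₀ 0)
  have hN₁0 : 0 ≤ N₁ := (norm_nonneg _).trans (hN₁ 0)
  have hC0 : (0 : ℝ) ≤ C := C.2
  set δ : ℕ → ℝ := fun n => 1 / ((n : ℝ) + 1) with hδ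
  have hδ0 : ∀ n, 0 < δ n := fun n => by simp only [hδ]; positivity
  have hδ1 : ∀ n, δ n ≤ 1 := fun n => by
    simp only [hδ]
    rw [div_le_one (by positivity)]
    linarith [(Nat.cast_nonneg n : (0 : ℝ) ≤ n)]
  have hδt : Tendsto δ atTop (𝓝 0) := tendsto_one_div_add_atTop_nhds_zero_nat
  obtain ⟨G, hG, hGg, hG', hGt⟩ := exists_smooth_approx_of_lipschitz h.lipschitz
    (ε := fun n => δ n ^ 2) (fun n => pow_pos (hδ0 n) 2) (by simpa using hδt.pow 2)
  set w : ℕ → Plane → ℝ := fun n x => rotCoord R 1 (x - p) - G n (rotCoord R 0 (x - p)) with hw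
  set ρ : ℕ → Plane → ℝ := fun n x => ψ x * (δ n * η (w n x / δ n)) with hρ
  set w' : ℕ → Plane → (Plane →L[ℝ] ℝ) := fun n x =>
    rotCoord R 1 - deriv (G n) (rotCoord R 0 (x - p)) • rotCoord R 0 with hw'
  have hwd : ∀ n x, HasFDerivAt (w n) (w' n x) x := fun n x => by
    have h0 : ∀ i, HasFDerivAt (fun x : Plane => rotCoord R i (x - p)) (rotCoord R i) x :=
      fun i => (rotCoord R i).hasFDerivAt.comp x ((hasFDerivAt_id x).sub_const p)
    have h1 := ((hG n).differentiable (by simp) (rotCoord R 0 (x - p))).hasDerivAt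
    exact (h0 1).sub (h1.comp_hasFDerivAt x (h0 0))
  have hρd : ∀ n x, HasFDerivAt (ρ n)
      (ψ x • (deriv η (w n x / δ n) • w' n x) + (δ n * η (w n x / δ n)) • fderiv ℝ ψ x) x := by
    intro n x
    have h1 := (hη.differentiable (by simp) (w n x / δ n)).hasDerivAt
    have h2 : HasFDerivAt (fun x => w n x / δ n) ((δ n)⁻¹ • w' n x) x := by
      simpa [div_eq_mul_inv] using (hwd n x).mul_const (δ n)⁻¹
    have h3 := (h1.comp_hasFDerivAt x h2).const_mul (δ n)
    have h4 := (hψ.differentiable (by simp) x).hasFDerivAt.mul h3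
    refine h4.congr_fderiv ?_
    congr 2
    have := (hδ0 n).ne'
    rw [smul_comm (deriv η _), smul_smul (δ n), mul_inv_cancel₀ this, one_smul]
  have hwn : ∀ n x, ‖w' n x‖ ≤ 1 + C := fun n x => by
    refine (norm_sub_le _ _).trans (add_le_add (norm_rotCoord_le R 1) ?_)
    rw [norm_smul]
    exact (mul_le_mul (hG' n _) (norm_rotCoord_le R 0) (norm_nonneg _) hC0).trans_eq (mul_one _)
  have hφd : ∀ n x, HasFDerivAt (fun x => (ρ n x : ℂ)) (Complex.ofRealCLM.comp
      (ψ x • (deriv η (w n x / δ n) • w' n x) + (δ n * η (w n x / δ n)) • fderiv ℝ ψ x)) x :=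
    fun n x => Complex.ofRealCLM.hasFDerivAt.comp x (hρd n x)
  have hρsm : ∀ n, ContDiff ℝ ∞ (ρ n) := fun n => by
    have h0 : ∀ i, ContDiff ℝ ∞ (fun x : Plane => rotCoord R i (x - p)) :=
      fun i => (rotCoord R i).contDiff.comp (contDiff_id.sub contDiff_const)
    have h1 : ContDiff ℝ ∞ (w n) := (h0 1).sub ((hG n).comp (h0 0))
    exact hψ.mul (contDiff_const.mul (hη.comp (h1.div_const _)))
  have hρb : ∀ n x, ‖ρ n x‖ ≤ N₀ * M₀ * δ n := fun n x => by
    simp only [hρ, norm_mul, Real.norm_of_nonneg (hδ0 n).le]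
    calc ‖ψ x‖ * (δ n * ‖η (w n x / δ n)‖) ≤ N₀ * (δ n * M₀) := by
          have := (hδ0 n).le
          gcongr
          · exact hN₀ x
          · exact hM₀ _
      _ = _ := by ring
  have hzero : ∀ n x, x ∉ V → fderiv ℝ (fun x => (ρ n x : ℂ)) x = 0 := fun n x hx => by
    have hx' : x ∉ tsupport ψ := fun hm => hx (hψV hm)
    have h1 : ψ x = 0 := image_eq_zero_of_notMem_tsupport hx'
    have h2 : fderiv ℝ ψ x = 0 :=
      image_eq_zero_of_notMem_tsupport fun hm => hx' (tsupport_fderiv_subset ℝ hm)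
    rw [(hφd n x).fderiv, h1, h2]
    simp
  refine ⟨fun n x => (ρ n x : ℂ), max (N₀ * M₀) (N₀ * (M₁ * (1 + C)) + M₀ * N₁), fun n => ⟨?_, ?_⟩,
    fun n x => ?_, fun n x => ?_, fun x => ?_, fun x hx => ?_, ?_⟩
  · exact Complex.ofRealCLM.contDiff.comp (hρsm n)
  · exact (hψc.mul_right (f' := fun x => δ n * η (w n x / δ n))).comp_left (g := ((↑) : ℝ → ℂ))
      Complex.ofReal_zero
  · rw [Complex.norm_real]
    refine (hρb n x).trans (le_max_of_le_left ?_)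
    exact mul_le_of_le_one_right (by positivity) (hδ1 n)
  · rw [(hφd n x).fderiv]
    refine (ContinuousLinearMap.opNorm_comp_le _ _).trans (le_max_of_le_right ?_)
    rw [Complex.ofRealCLM_norm, one_mul]
    refine (norm_add_le _ _).trans ?_
    simp only [norm_smul, norm_mul, Real.norm_of_nonneg (hδ0 n).le]
    have h1 : δ n * ‖η (w n x / δ n)‖ ≤ M₀ :=
      (mul_le_of_le_one_left (norm_nonneg _) (hδ1 n)).trans (hM₀ _)
    gcongr
    · exact hN₀ x
    · exact hM₁ _
    · exact hwn n x
    · exact hN₁ x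
  · refine squeeze_zero_norm (a := fun n => N₀ * M₀ * δ n) (fun n => ?_) ?_
    · rw [Complex.norm_real]
      exact hρb n x
    · simpa using hδt.const_mul (N₀ * M₀)
  · by_cases hxV : x ∈ V
    · have hc := (h.mem_iff x hxV).1 hx
      set c := g (rotCoord R 0 (x - p)) - rotCoord R 1 (x - p) with hcdef
      have hc0 : 0 < c := sub_pos.2 hc
      have hlim : Tendsto (fun n => c - C * δ n ^ 2 - r * δ n) atTop (𝓝 c) := by
        have := (tendsto_const_nhds (x := c)).sub ((hδt.pow 2).const_mul (C : ℝ)) |>.sub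
          (hδt.const_mul r)
        simpa using this
      refine tendsto_const_nhds.congr' ?_
      filter_upwards [hlim.eventually (lt_mem_nhds hc0)] with n hn
      have hbig : r < |w n x / δ n| := by
        rw [abs_div, abs_of_pos (hδ0 n), lt_div_iff₀ (hδ0 n)]
        have h1 := abs_le.1 (hGg n (rotCoord R 0 (x - p)))
        have h2 : c - C * δ n ^ 2 ≤ -w n x := by simp only [hw, hcdef]; linarith [h1.1]
        linarith [neg_le_abs (w n x)]
      rw [(hφd n x).fderiv, (hr _ hbig).1, (hr _ hbig).2]
      simp
    · simp only [hzero _ x hxV]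
      exact tendsto_const_nhds
  · have hm : MeasurableSet (V ∩ S.Γ) := h.isOpen.measurableSet.inter S.measurableSet_Γ
    have hn := S.ae_normal_eq h hΓ
    have hd := ae_arcLength_of_ae_graph (p := p) (R := R) h.lipschitz hm hΓ hGt
    rw [arcLength, ae_restrict_iff' hm] at hn hd
    rw [arcLength, ae_restrict_iff' S.measurableSet_Γ]
    filter_upwards [hn, hd] with x hnx hdx hxΓ
    by_cases hxV : x ∈ V
    · have hnx := hnx ⟨hxV, hxΓ⟩
      have hdx := hdx ⟨hxV, hxΓ⟩
      set s := deriv g (rotCoord R 0 (x - p)) with hs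
      have hwt : Tendsto (fun n => w n x / δ n) atTop (𝓝 0) := by
        refine squeeze_zero_norm (a := fun n => C * δ n) (fun n => ?_)
          (by simpa using hδt.const_mul (C : ℝ))
        have h1 := hGg n (rotCoord R 0 (x - p))
        have h2 : w n x = -(G n (rotCoord R 0 (x - p)) - g (rotCoord R 0 (x - p))) := by
          simp only [hw, hΓ x ⟨hxV, hxΓ⟩]; ring
        rw [Real.norm_eq_abs, abs_div, abs_of_pos (hδ0 n), div_le_iff₀ (hδ0 n), h2, abs_neg]
        exact h1.trans_eq (by ring)
      have h1 : Tendsto (fun n => deriv η (w n x / δ n)) atTop (𝓝 1) := by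
        rw [← hη1]
        exact (hη'.tendsto 0).comp hwt
      have h2 : Tendsto (fun n => δ n * η (w n x / δ n)) atTop (𝓝 0) := by
        have := hδt.mul ((hη.continuous.tendsto 0).comp hwt)
        simpa using this
      have h3 : Tendsto (fun n => ψ x * (deriv η (w n x / δ n) *
            (1 / slopeNorm s - deriv (G n) (rotCoord R 0 (x - p)) * (-s / slopeNorm s)))
          + δ n * η (w n x / δ n) * fderiv ℝ ψ x (graphNormal R s)) atTop
          (𝓝 (ψ x * (1 * (1 / slopeNorm s - s * (-s / slopeNorm s)))
            + 0 * fderiv ℝ ψ x (graphNormal R s))) :=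
        ((h1.mul (tendsto_const_nhds.sub (hdx.mul_const _))).const_mul _).add (h2.mul_const _)
      have h4 : ψ x * (1 * (1 / slopeNorm s - s * (-s / slopeNorm s)))
            + 0 * fderiv ℝ ψ x (graphNormal R s) = ψ x * slopeNorm s := by
        have hm0 : slopeNorm s ≠ 0 := (zero_lt_one.trans_le (one_le_slopeNorm s)).ne'
        have : 1 / slopeNorm s - s * (-s / slopeNorm s) = slopeNorm s := by
          field_simp
          rw [pow_two (slopeNorm s), slopeNorm_mul_self]
          ring
        rw [this]; ring
      rw [h4] at h3
      refine ((Complex.continuous_ofReal.tendsto _).comp h3).congr fun n => ?_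
      simp only [Configuration.dn]
      rw [(hφd n x).fderiv, hnx]
      simp [hw', graphNormal]
    · have hψ0 : ψ x = 0 := image_eq_zero_of_notMem_tsupport fun hm => hxV (hψV hm)
      simp only [Configuration.dn, hzero _ x hxV, hψ0]
      simp

/-! ### Uniqueness of the coefficient of the normal derivative -/

theorem norm_pderiv_le (i : Fin 2) (φ : Plane → ℂ) (x : Plane) :
    ‖pderiv i φ x‖ ≤ ‖fderiv ℝ φ x‖ :=
  (ContinuousLinearMap.le_opNorm _ _).trans_eq (by simp)

theorem continuous_pderiv {φ : Plane → ℂ} (hφ : ContDiff ℝ ∞ φ) (i : Fin 2) :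
    Continuous (pderiv i φ) :=
  (hφ.continuous_fderiv (by simp)).clm_apply continuous_const

theorem tendsto_integral_bounded_mul {μ : Measure Plane} {a : ℕ → Plane → ℂ} {a₀ F : Plane → ℂ}
    {M : ℝ} (ha : ∀ n, AEStronglyMeasurable (a n) μ) (hb : ∀ n x, ‖a n x‖ ≤ M)
    (hF : Integrable F μ) (ht : ∀ᵐ x ∂μ, Tendsto (fun n => a n x) atTop (𝓝 (a₀ x))) :
    Tendsto (fun n => ∫ x, a n x * F x ∂μ) atTop (𝓝 (∫ x, a₀ x * F x ∂μ)) := by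
  refine tendsto_integral_of_dominated_convergence (fun x => M * ‖F x‖)
    (fun n => (ha n).mul hF.1) (hF.norm.const_mul M) (fun n => Eventually.of_forall fun x => ?_)
    (ht.mono fun x hx => hx.mul_const _)
  rw [norm_mul]
  exact mul_le_mul_of_nonneg_right (hb n x) (norm_nonneg _)

theorem Configuration.normal_coeff_eq_zero (S : Configuration) {F Q B : Plane → ℂ}
    {G : Fin 2 → Plane → ℂ} (hF : Integrable F (volume.restrict S.Ω))
    (hG : ∀ i, Integrable (G i) (volume.restrict S.Ω)) (hQ : Integrable Q (arcLength S.Γ))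
    (hB : Integrable B (arcLength S.Γ))
    (h : ∀ φ, IsTest φ → (∑ i, ∫ x in S.Ω, pderiv i φ x * G i x) + (∫ x in S.Ω, φ x * F x)
      + (∫ x, φ x * Q x ∂(arcLength S.Γ)) + (∫ x, S.dn φ x * B x ∂(arcLength S.Γ)) = 0) :
    ∀ᵐ x ∂(arcLength S.Γ), B x = 0 := by
  refine S.isCompact_Γ.induction_on (p := fun s => ∀ᵐ x ∂(arcLength s), B x = 0) ?_ ?_ ?_ ?_
  · simp [arcLength]
  · exact fun s t hst ht => ae_restrict_of_ae_restrict_of_subset hst ht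
  · exact fun s t hs ht => (ae_restrict_union_iff s t _).2 ⟨hs, ht⟩
  intro p hp
  obtain ⟨V, R, g, C, hpV, hch, hΓ⟩ := S.exists_chart hp
  refine ⟨V ∩ S.Γ, Filter.inter_mem (mem_nhdsWithin_of_mem_nhds (hch.isOpen.mem_nhds hpV))
    self_mem_nhdsWithin, ?_⟩
  set m : Plane → ℝ := fun x => slopeNorm (deriv g (rotCoord R 0 (x - p))) with hm
  have hmm : Measurable m := by
    have h1 : Measurable slopeNorm := by unfold slopeNorm; fun_prop
    exact h1.comp ((measurable_deriv g).comp (by fun_prop))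
  have hmb : ∀ x, ‖m x‖ ≤ Real.sqrt (1 + C ^ 2) := fun x => by
    have h1 : ‖deriv g (rotCoord R 0 (x - p))‖ ≤ C := norm_deriv_le_of_lipschitz hch.lipschitz
    simp only [hm, slopeNorm]
    rw [Real.norm_of_nonneg (Real.sqrt_nonneg _)]
    refine Real.sqrt_le_sqrt ?_
    have := sq_le_sq' (by linarith [(abs_le.1 h1).1]) (abs_le.1 h1).2
    linarith
  have hmB : Integrable (fun x => m x • B x) (arcLength S.Γ) :=
    hB.bdd_smul (Real.sqrt (1 + C ^ 2)) hmm.aestronglyMeasurable (Eventually.of_forall hmb)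
  have hzero : ∀ ψ : Plane → ℝ, ContDiff ℝ ∞ ψ → HasCompactSupport ψ → tsupport ψ ⊆ V →
      ∫ x, ψ x • (m x • B x) ∂(arcLength S.Γ) = 0 := by
    intro ψ hψ hψc hψV
    obtain ⟨φ, M, hφ, hb, hb', hlim, hlim', hdn⟩ :=
      S.exists_normal_concentration hch hΓ hψ hψc hψV
    have t1 : ∀ i, Tendsto (fun n => ∫ x in S.Ω, pderiv i (φ n) x * G i x) atTop (𝓝 0) := by
      intro i
      have := tendsto_integral_bounded_mul (a := fun n => pderiv i (φ n)) (a₀ := 0)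
        (fun n => (continuous_pderiv (hφ n).1 i).aestronglyMeasurable)
        (fun n x => (norm_pderiv_le i _ x).trans (hb' n x)) (hG i) <| by
          filter_upwards [ae_restrict_mem S.isOpen_Ω.measurableSet] with x hx
          have := ((ContinuousLinearMap.apply ℝ ℂ (EuclideanSpace.single i (1 : ℝ) :
            Plane)).continuous.tendsto 0).comp (hlim' x hx)
          simpa [pderiv, Function.comp_def] using this
      simpa using this
    have t2 : Tendsto (fun n => ∫ x in S.Ω, φ n x * F x) atTop (𝓝 0) := by
      have := tendsto_integral_bounded_mul (a := φ) (a₀ := 0)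
        (fun n => (hφ n).1.continuous.aestronglyMeasurable) hb hF (Eventually.of_forall hlim)
      simpa using this
    have t3 : Tendsto (fun n => ∫ x, φ n x * Q x ∂(arcLength S.Γ)) atTop (𝓝 0) := by
      have := tendsto_integral_bounded_mul (a := φ) (a₀ := 0)
        (fun n => (hφ n).1.continuous.aestronglyMeasurable) hb hQ (Eventually.of_forall hlim)
      simpa using this
    have t4 := tendsto_integral_bounded_mul (a := fun n => S.dn (φ n))
        (fun n => S.aestronglyMeasurable_dn (hφ n).1)
        (fun n x => (S.norm_dn_le _ x).trans (hb' n x)) hB hdn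
    have t := (((tendsto_finsetSum Finset.univ fun i _ => t1 i).add t2).add t3).add t4
    simp only [h _ (hφ _)] at t
    have := tendsto_nhds_unique t tendsto_const_nhds
    simp only [Finset.sum_const_zero, zero_add] at this
    rw [← this]
    congr 1 with x
    simp only [Complex.real_smul, hm]
    push_cast
    ring
  have hae := hch.isOpen.ae_eq_zero_of_integral_contDiff_smul_eq_zero
    (hmB.locallyIntegrable.locallyIntegrableOn V) hzero
  rw [arcLength, ae_restrict_iff' S.measurableSet_Γ] at hae
  rw [arcLength, ae_restrict_iff' (hch.isOpen.measurableSet.inter S.measurableSet_Γ)]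
  filter_upwards [hae] with x hx hxV
  exact (smul_eq_zero.1 (hx hxV.2 hxV.1)).resolve_left
    (zero_lt_one.trans_le (one_le_slopeNorm _)).ne'

/-! ### The complex pairing -/

theorem memLp_conj {μ : Measure Plane} {f : Plane → ℂ} (hf : MemLp f 2 μ) :
    MemLp (fun x => conj (f x)) 2 μ := hf.star

theorem integrable_mul_conj {μ : Measure Plane} {f g : Plane → ℂ} (hf : MemLp f 2 μ)
    (hg : MemLp g 2 μ) : Integrable (fun x => f x * conj (g x)) μ :=
  hf.integrable_mul (memLp_conj hg)

/-- The pairing `∫ f ḡ dμ`, whose real part is `innerRe`. -/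
def pairing (μ : Measure Plane) (f g : Plane → ℂ) : ℂ := ∫ x, f x * conj (g x) ∂μ

section pairing

variable {μ : Measure Plane} {f f' g g' : Plane → ℂ}

theorem innerRe_eq_re_pairing : innerRe μ f g = (pairing μ f g).re := rfl

theorem pairing_add_left (hf : MemLp f 2 μ) (hf' : MemLp f' 2 μ) (hg : MemLp g 2 μ) :
    pairing μ (fun x => f x + f' x) g = pairing μ f g + pairing μ f' g := by
  simp only [pairing, add_mul]
  exact integral_add (integrable_mul_conj hf hg) (integrable_mul_conj hf' hg)

theorem pairing_add_right (hf : MemLp f 2 μ) (hg : MemLp g 2 μ) (hg' : MemLp g' 2 μ) :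
    pairing μ f (fun x => g x + g' x) = pairing μ f g + pairing μ f g' := by
  simp only [pairing, map_add, mul_add]
  exact integral_add (integrable_mul_conj hf hg) (integrable_mul_conj hf hg')

theorem pairing_const_mul_left (c : ℂ) :
    pairing μ (fun x => c * f x) g = c * pairing μ f g := by
  simp only [pairing, mul_assoc]
  exact integral_const_mul _ _

theorem pairing_const_mul_right (c : ℂ) :
    pairing μ f (fun x => c * g x) = conj c * pairing μ f g := by
  simp only [pairing, map_mul, mul_left_comm _ (conj c)]
  exact integral_const_mul _ _

theorem conj_pairing : conj (pairing μ f g) = pairing μ g f := by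
  simp only [pairing, ← integral_conj, map_mul, Complex.conj_conj, mul_comm]

theorem innerRe_comm : innerRe μ f g = innerRe μ g f := by
  rw [innerRe_eq_re_pairing, innerRe_eq_re_pairing, ← conj_pairing, Complex.conj_re]

theorem innerRe_add_smul_left (ε : ℝ) (hf : MemLp f 2 μ) (hf' : MemLp f' 2 μ) (hg : MemLp g 2 μ) :
    innerRe μ (fun x => f x + ε * f' x) g = innerRe μ f g + ε * innerRe μ f' g := by
  simp only [innerRe_eq_re_pairing]
  rw [pairing_add_left hf (hf'.const_mul _) hg, pairing_const_mul_left, Complex.add_re,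
    Complex.re_ofReal_mul]

theorem pairing_arcLength_indicator {A Γ : Set Plane} (hA : MeasurableSet A) (hAΓ : A ⊆ Γ) :
    pairing (arcLength Γ) f (A.indicator g) = pairing (arcLength A) f g := by
  have h : (fun x => f x * conj (A.indicator g x)) = A.indicator fun x => f x * conj (g x) := by
    funext x
    by_cases hx : x ∈ A <;> simp [hx]
  rw [pairing, h, integral_indicator hA, arcLength, Measure.restrict_restrict hA,
    Set.inter_eq_left.2 hAΓ]
  rfl

theorem hasDerivAt_innerRe {F : ℝ → Plane → ℂ} (hF : ∀ ε x, F ε x = f x + ε * f' x)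
    (hf : MemLp f 2 μ) (hf' : MemLp f' 2 μ) (hg : MemLp g 2 μ) :
    HasDerivAt (fun ε => innerRe μ (F ε) g) (innerRe μ f' g) 0 := by
  have e : (fun ε => innerRe μ (F ε) g) = fun ε => innerRe μ f g + ε * innerRe μ f' g := by
    funext ε
    rw [funext (hF ε), innerRe_add_smul_left ε hf hf' hg]
  rw [e]
  simpa using ((hasDerivAt_id (0 : ℝ)).mul_const (innerRe μ f' g)).const_add (innerRe μ f g)

theorem hasDerivAt_innerRe_self {F : ℝ → Plane → ℂ} (hF : ∀ ε x, F ε x = f x + ε * f' x)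
    (hf : MemLp f 2 μ) (hf' : MemLp f' 2 μ) :
    HasDerivAt (fun ε => innerRe μ (F ε) (F ε)) (2 * innerRe μ f' f) 0 := by
  have e : (fun ε => innerRe μ (F ε) (F ε)) = fun ε =>
      innerRe μ f f + (ε * (2 * innerRe μ f' f) + ε ^ 2 * innerRe μ f' f') := by
    funext ε
    have hsum : MemLp (fun x => f x + ε * f' x) 2 μ := hf.add (hf'.const_mul _)
    rw [funext (hF ε), innerRe_add_smul_left ε hf hf' hsum, innerRe_comm (f := f),
      innerRe_comm (f := f'), innerRe_add_smul_left ε hf hf' hf,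
      innerRe_add_smul_left ε hf hf' hf', innerRe_comm (f := f) (g := f')]
    ring
  rw [e]
  have h := (((hasDerivAt_id (0 : ℝ)).mul_const (2 * innerRe μ f' f)).add
    (((hasDerivAt_id (0 : ℝ)).pow 2).mul_const (innerRe μ f' f'))).const_add (innerRe μ f f)
  simpa using h

end pairing

/-! ### Smooth functions on the domain and on its boundary -/

namespace Configuration

variable (S : Configuration)

theorem memLp_Ω_of_continuous {f : Plane → ℂ} (hf : Continuous f) :
    MemLp f 2 (volume.restrict S.Ω) := by
  obtain ⟨M, hM⟩ := S.isBounded_Ω.isCompact_closure.exists_bound_of_continuousOn hf.continuousOn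
  refine MemLp.of_bound hf.aestronglyMeasurable M ?_
  filter_upwards [ae_restrict_mem S.isOpen_Ω.measurableSet] with x hx
  exact hM x (subset_closure hx)

theorem memLp_Γ_of_continuous {f : Plane → ℂ} (hf : Continuous f) :
    MemLp f 2 (arcLength S.Γ) := by
  obtain ⟨M, hM⟩ := S.isCompact_Γ.exists_bound_of_continuousOn hf.continuousOn
  refine MemLp.of_bound hf.aestronglyMeasurable M ?_
  filter_upwards [ae_restrict_mem S.measurableSet_Γ] with x hx
  exact hM x hx

theorem memLp_dn {φ : Plane → ℂ} (hφ : ContDiff ℝ ∞ φ) : MemLp (S.dn φ) 2 (arcLength S.Γ) := by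
  obtain ⟨M, hM⟩ := S.isCompact_Γ.exists_bound_of_continuousOn
    (hφ.continuous_fderiv (by simp)).continuousOn
  refine MemLp.of_bound (S.aestronglyMeasurable_dn hφ) M ?_
  filter_upwards [ae_restrict_mem S.measurableSet_Γ] with x hx
  exact (S.norm_dn_le φ x).trans (hM x hx)

theorem Γ₁_subset : S.Γ₁ ⊆ S.Γ := fun _ h => Or.inl (Or.inl (Or.inl (Or.inl h)))
theorem Γ₂_subset : S.Γ₂ ⊆ S.Γ := fun _ h => Or.inl (Or.inl (Or.inl (Or.inr h)))
theorem Γ₃_subset : S.Γ₃ ⊆ S.Γ := fun _ h => Or.inl (Or.inl (Or.inr h))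
theorem Γ₄_subset : S.Γ₄ ⊆ S.Γ := fun _ h => Or.inl (Or.inr h)
theorem Γ₅_subset : S.Γ₅ ⊆ S.Γ := fun _ h => Or.inr h
theorem Γ₁_union_Γ₅_subset : S.Γ₁ ∪ S.Γ₅ ⊆ S.Γ := Set.union_subset S.Γ₁_subset S.Γ₅_subset

theorem measurable₅ : MeasurableSet S.Γ₅ := isClosed_frontier.measurableSet

end Configuration

theorem memLp_arcLength_mono {A B : Set Plane} (h : A ⊆ B) {f : Plane → ℂ}
    (hf : MemLp f 2 (arcLength B)) : MemLp f 2 (arcLength A) :=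
  hf.mono_measure (Measure.restrict_mono_set _ h)

theorem memLp_arcLength_indicator {A B : Set Plane} (hA : MeasurableSet A) (h : A ⊆ B)
    {f : Plane → ℂ} (hf : MemLp f 2 (arcLength A)) : MemLp (A.indicator f) 2 (arcLength B) := by
  rw [memLp_indicator_iff_restrict hA, arcLength, Measure.restrict_restrict hA,
    Set.inter_eq_left.2 h]
  exact hf

theorem contDiff_incoming (k A θ : ℝ) : ContDiff ℝ ∞ (incoming k A θ) := by
  have h : ContDiff ℝ ∞ fun x : Plane => x 0 * Real.cos θ + x 1 * Real.sin θ := by fun_prop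
  exact contDiff_const.mul (contDiff_const.mul (Complex.ofRealCLM.contDiff.comp h)).cexp

theorem conj_alpha (K : ℝ) : conj (alpha K) = -alpha K := by
  apply Complex.ext <;> simp [alpha]

/-! ### The derivative of the Lagrangian -/

/-- The function paired with the normal derivative of a variation in the derivative of the
Lagrangian. -/
def normalCoeff (S : Configuration) (v : TracedField) (v₁ v₃ : Plane → ℂ) (x : Plane) : ℂ :=
  v.trace x + (S.Γ₁ ∪ S.Γ₅).indicator v₁ x + S.Γ₄.indicator v₃ x

/-- The function paired with the boundary values of a variation in the derivative of the
Lagrangian. -/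
def traceCoeff (S : Configuration) (k K : ℝ) (u₀ : Plane → ℂ) (u : CauchyField)
    (v₁ v₂ v₃ : Plane → ℂ) (x : Plane) : ℂ :=
  S.Γ₁.indicator (fun x => u.trace x - u₀ x) x + k * alpha K * (S.Γ₁ ∪ S.Γ₅).indicator v₁ x
    + S.Γ₂.indicator v₂ x + S.Γ₃.indicator v₂ x + -(Complex.I * k) * S.Γ₄.indicator v₃ x

/-- The complex linear form whose real part is the derivative of the Lagrangian. -/
def variation (S : Configuration) (k : ℝ) (v : TracedField) (b q φ : Plane → ℂ) : ℂ :=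
  ∑ i, pairing (volume.restrict S.Ω) (pderiv i φ) (v.grad i)
    - k ^ 2 * pairing (volume.restrict S.Ω) φ v.fn
    + pairing (arcLength S.Γ) φ q - pairing (arcLength S.Γ) (S.dn φ) b

section

variable {S : Configuration} {k A θ K : ℝ} {u₀ : Plane → ℂ} {u : CauchyField} {v : TracedField}
  {v₁ v₂ v₃ : Plane → ℂ}

theorem memLp_normalCoeff (hv : MemLp v.trace 2 (arcLength S.Γ))
    (h₁ : MemLp v₁ 2 (arcLength (S.Γ₁ ∪ S.Γ₅))) (h₃ : MemLp v₃ 2 (arcLength S.Γ₄)) :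
    MemLp (normalCoeff S v v₁ v₃) 2 (arcLength S.Γ) :=
  (hv.add (memLp_arcLength_indicator (S.measurable₁.union S.measurable₅) S.Γ₁_union_Γ₅_subset
    h₁)).add (memLp_arcLength_indicator S.measurable₄ S.Γ₄_subset h₃)

theorem memLp_traceCoeff (hu₀ : MemLp u₀ 2 (arcLength S.Γ₁))
    (hu : MemLp u.trace 2 (arcLength S.Γ)) (h₁ : MemLp v₁ 2 (arcLength (S.Γ₁ ∪ S.Γ₅)))
    (h₂ : MemLp v₂ 2 (arcLength (S.Γ₂ ∪ S.Γ₃))) (h₃ : MemLp v₃ 2 (arcLength S.Γ₄)) :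
    MemLp (traceCoeff S k K u₀ u v₁ v₂ v₃) 2 (arcLength S.Γ) :=
  ((((memLp_arcLength_indicator S.measurable₁ S.Γ₁_subset
    ((memLp_arcLength_mono S.Γ₁_subset hu).sub hu₀)).add
    ((memLp_arcLength_indicator (S.measurable₁.union S.measurable₅) S.Γ₁_union_Γ₅_subset
      h₁).const_mul _)).add
    (memLp_arcLength_indicator S.measurable₂ S.Γ₂_subset
      (memLp_arcLength_mono Set.subset_union_left h₂))).add
    (memLp_arcLength_indicator S.measurable₃ S.Γ₃_subset
      (memLp_arcLength_mono Set.subset_union_right h₂))).add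
    ((memLp_arcLength_indicator S.measurable₄ S.Γ₄_subset h₃).const_mul _)

theorem pairing_normalCoeff (hv : MemLp v.trace 2 (arcLength S.Γ))
    (h₁ : MemLp v₁ 2 (arcLength (S.Γ₁ ∪ S.Γ₅))) (h₃ : MemLp v₃ 2 (arcLength S.Γ₄))
    {f : Plane → ℂ} (hf : MemLp f 2 (arcLength S.Γ)) :
    pairing (arcLength S.Γ) f (normalCoeff S v v₁ v₃) = pairing (arcLength S.Γ) f v.trace
      + pairing (arcLength (S.Γ₁ ∪ S.Γ₅)) f v₁ + pairing (arcLength S.Γ₄) f v₃ := by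
  have m₁₅ := S.measurable₁.union S.measurable₅
  have i₁ := memLp_arcLength_indicator m₁₅ S.Γ₁_union_Γ₅_subset h₁
  have i₃ := memLp_arcLength_indicator S.measurable₄ S.Γ₄_subset h₃
  rw [← pairing_arcLength_indicator m₁₅ S.Γ₁_union_Γ₅_subset,
    ← pairing_arcLength_indicator S.measurable₄ S.Γ₄_subset, ← pairing_add_right hf hv i₁]
  exact pairing_add_right hf (hv.add i₁) i₃

theorem pairing_traceCoeff (hu₀ : MemLp u₀ 2 (arcLength S.Γ₁))
    (hu : MemLp u.trace 2 (arcLength S.Γ)) (h₁ : MemLp v₁ 2 (arcLength (S.Γ₁ ∪ S.Γ₅)))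
    (h₂ : MemLp v₂ 2 (arcLength (S.Γ₂ ∪ S.Γ₃))) (h₃ : MemLp v₃ 2 (arcLength S.Γ₄))
    {f : Plane → ℂ} (hf : MemLp f 2 (arcLength S.Γ)) :
    pairing (arcLength S.Γ) f (traceCoeff S k K u₀ u v₁ v₂ v₃)
      = pairing (arcLength S.Γ₁) f (fun x => u.trace x - u₀ x)
        - k * alpha K * pairing (arcLength (S.Γ₁ ∪ S.Γ₅)) f v₁
        + pairing (arcLength S.Γ₂) f v₂ + pairing (arcLength S.Γ₃) f v₂
        + Complex.I * k * pairing (arcLength S.Γ₄) f v₃ := by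
  have m₁₅ := S.measurable₁.union S.measurable₅
  have i₀ := memLp_arcLength_indicator S.measurable₁ S.Γ₁_subset
    ((memLp_arcLength_mono S.Γ₁_subset hu).sub hu₀)
  have i₁ := (memLp_arcLength_indicator m₁₅ S.Γ₁_union_Γ₅_subset h₁).const_mul
    (k * alpha K)
  have i₂ := memLp_arcLength_indicator S.measurable₂ S.Γ₂_subset
    (memLp_arcLength_mono Set.subset_union_left h₂)
  have i₂' := memLp_arcLength_indicator S.measurable₃ S.Γ₃_subset
    (memLp_arcLength_mono Set.subset_union_right h₂)
  have i₃ := (memLp_arcLength_indicator S.measurable₄ S.Γ₄_subset h₃).const_mul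
    (-(Complex.I * k))
  have e := pairing_add_right hf (((i₀.add i₁).add i₂).add i₂') i₃
  have e' := pairing_add_right hf ((i₀.add i₁).add i₂) i₂'
  have e'' := pairing_add_right hf (i₀.add i₁) i₂
  have e''' := pairing_add_right hf i₀ i₁
  simp only [Pi.add_apply] at e e' e'' e'''
  rw [pairing_const_mul_right, pairing_arcLength_indicator m₁₅ S.Γ₁_union_Γ₅_subset] at e'''
  rw [pairing_const_mul_right, pairing_arcLength_indicator S.measurable₄ S.Γ₄_subset] at e
  have hc : conj ((k : ℂ) * alpha K) = -(k * alpha K) := by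
    rw [map_mul, conj_alpha, Complex.conj_ofReal]; ring
  have hI : conj (-(Complex.I * (k : ℂ))) = Complex.I * k := by simp
  refine e.trans ?_
  rw [hI]
  congr 1
  refine e'.trans ?_
  rw [pairing_arcLength_indicator S.measurable₃ S.Γ₃_subset]
  congr 1
  refine e''.trans ?_
  rw [pairing_arcLength_indicator S.measurable₂ S.Γ₂_subset]
  congr 1
  refine e'''.trans ?_
  rw [hc, neg_mul, ← sub_eq_add_neg]
  congr 1
  exact pairing_arcLength_indicator S.measurable₁ S.Γ₁_subset

theorem hasDerivAt_lagrangian (hu₀ : MemLp u₀ 2 (arcLength S.Γ₁))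
    (hu : IsStateSolution S k A θ K u) (hv : S.MemH1 v)
    (h₁ : MemLp v₁ 2 (arcLength (S.Γ₁ ∪ S.Γ₅))) (h₂ : MemLp v₂ 2 (arcLength (S.Γ₂ ∪ S.Γ₃)))
    (h₃ : MemLp v₃ 2 (arcLength S.Γ₄)) {φ : Plane → ℂ} (hφ : ContDiff ℝ ∞ φ) :
    HasDerivAt (fun ε : ℝ => lagrangian S k A θ K u₀ (S.perturb u ε φ) v v₁ v₂ v₃)
      (variation S k v (normalCoeff S v v₁ v₃) (traceCoeff S k K u₀ u v₁ v₂ v₃) φ).re 0 := by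
  have tu : MemLp u.trace 2 (arcLength S.Γ) := hu.memH1.2.1
  have du : MemLp u.normalDeriv 2 (arcLength S.Γ) := hu.normalDeriv.1
  have tv : MemLp v.trace 2 (arcLength S.Γ) := hv.2.1
  have tφ := S.memLp_Γ_of_continuous hφ.continuous
  have dφ := S.memLp_dn hφ
  have ti := S.memLp_Γ_of_continuous (contDiff_incoming k A θ).continuous
  have di := S.memLp_dn (contDiff_incoming k A θ)
  have s₁₅ := S.Γ₁_union_Γ₅_subset
  have d0 := (hasDerivAt_innerRe_self (F := fun ε x => (S.perturb u ε φ).trace x - u₀ x)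
    (f := fun x => u.trace x - u₀ x) (f' := φ) (fun ε x => by simp only [Configuration.perturb]; ring)
    ((memLp_arcLength_mono S.Γ₁_subset tu).sub hu₀)
    (memLp_arcLength_mono S.Γ₁_subset tφ)).const_mul (1 / 2 : ℝ)
  have d1 : ∀ i, HasDerivAt (fun ε => innerRe (volume.restrict S.Ω) ((S.perturb u ε φ).grad i)
      (v.grad i)) _ 0 := fun i => hasDerivAt_innerRe (f := u.grad i) (f' := pderiv i φ)
    (fun ε x => rfl) (hu.memH1.1.2.1 i) (S.memLp_Ω_of_continuous (continuous_pderiv hφ i))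
    (hv.1.2.1 i)
  have d2 := (hasDerivAt_innerRe (F := fun ε => (S.perturb u ε φ).fn) (f := u.fn) (f' := φ)
    (fun ε x => rfl) hu.memH1.1.1 (S.memLp_Ω_of_continuous hφ.continuous) hv.1.1).const_mul (k ^ 2)
  have d3 := hasDerivAt_innerRe (F := fun ε => (S.perturb u ε φ).normalDeriv)
    (f := u.normalDeriv) (f' := S.dn φ) (fun ε x => rfl) du dφ tv
  have d4 := hasDerivAt_innerRe (F := fun ε x => (S.perturb u ε φ).normalDeriv x
      + k * alpha K * (S.perturb u ε φ).trace x)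
    (f := fun x => u.normalDeriv x + k * alpha K * u.trace x)
    (f' := fun x => S.dn φ x + k * alpha K * φ x)
    (fun ε x => by simp only [Configuration.perturb]; ring)
    (memLp_arcLength_mono s₁₅ (du.add (tu.const_mul _)))
    (memLp_arcLength_mono s₁₅ (dφ.add (tφ.const_mul _))) h₁
  have d5 := hasDerivAt_innerRe (F := fun ε => (S.perturb u ε φ).trace) (f := u.trace) (f' := φ)
    (fun ε x => rfl) (memLp_arcLength_mono S.Γ₂_subset tu) (memLp_arcLength_mono S.Γ₂_subset tφ)
    (memLp_arcLength_mono Set.subset_union_left h₂)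
  have d6 := hasDerivAt_innerRe (F := fun ε => (S.perturb u ε φ).trace) (f := u.trace) (f' := φ)
    (fun ε x => rfl) (memLp_arcLength_mono S.Γ₃_subset tu) (memLp_arcLength_mono S.Γ₃_subset tφ)
    (memLp_arcLength_mono Set.subset_union_right h₂)
  have d7 := hasDerivAt_innerRe
    (F := fun ε x => ((S.perturb u ε φ).normalDeriv x - S.dn (incoming k A θ) x)
          - Complex.I * k * ((S.perturb u ε φ).trace x - incoming k A θ x))
    (f := fun x => (u.normalDeriv x - S.dn (incoming k A θ) x)
          - Complex.I * k * (u.trace x - incoming k A θ x))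
    (f' := fun x => S.dn φ x + -(Complex.I * k) * φ x)
    (fun ε x => by simp only [Configuration.perturb]; ring)
    (memLp_arcLength_mono S.Γ₄_subset ((du.sub di).sub ((tu.sub ti).const_mul _)))
    (memLp_arcLength_mono S.Γ₄_subset (dφ.add (tφ.const_mul _))) h₃
  have d := ((((((d0.add (HasDerivAt.fun_sum fun i (_ : i ∈ Finset.univ) => d1 i)).sub d2).sub
    d3).sub d4).add d5).add d6).sub d7
  refine d.congr_deriv ?_
  rw [variation, pairing_normalCoeff tv h₁ h₃ dφ, pairing_traceCoeff hu₀ tu h₁ h₂ h₃ tφ]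
  simp only [innerRe_eq_re_pairing]
  rw [pairing_add_left (memLp_arcLength_mono s₁₅ dφ)
      ((memLp_arcLength_mono s₁₅ tφ).const_mul _) h₁, pairing_const_mul_left,
    pairing_add_left (memLp_arcLength_mono S.Γ₄_subset dφ)
      ((memLp_arcLength_mono S.Γ₄_subset tφ).const_mul _) h₃, pairing_const_mul_left]
  have hk2 : ∀ z : ℂ, ((k : ℂ) ^ 2 * z).re = k ^ 2 * z.re := fun z => by
    rw [← Complex.ofReal_pow, Complex.re_ofReal_mul]
  simp only [Complex.add_re, Complex.sub_re, Complex.re_sum, hk2, neg_mul, Complex.neg_re]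
  ring

theorem variation_const_mul {b q φ : Plane → ℂ} (c : ℂ) (hφ : ContDiff ℝ ∞ φ) :
    variation S k v b q (fun x => c * φ x) = c * variation S k v b q φ := by
  have hd : ∀ x, fderiv ℝ (fun x => c * φ x) x = c • fderiv ℝ φ x := fun x =>
    fderiv_const_mul (hφ.differentiable (by simp) x) c
  have h1 : ∀ i, pderiv i (fun x => c * φ x) = fun x => c * pderiv i φ x := fun i => by
    funext x; simp [pderiv, hd]
  have h2 : S.dn (fun x => c * φ x) = fun x => c * S.dn φ x := by
    funext x; simp [Configuration.dn, hd]
  simp only [variation, h1, h2, pairing_const_mul_left, ← Finset.mul_sum]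
  ring

theorem isAdjoint_iff_variation (hu₀ : MemLp u₀ 2 (arcLength S.Γ₁))
    (hu : IsStateSolution S k A θ K u) (hv : S.MemH1 v) :
    IsAdjoint S k A θ K u₀ u v ↔ ∃ v₁ v₂ v₃ : Plane → ℂ, MemLp v₁ 2 (arcLength (S.Γ₁ ∪ S.Γ₅)) ∧
      MemLp v₂ 2 (arcLength (S.Γ₂ ∪ S.Γ₃)) ∧ MemLp v₃ 2 (arcLength S.Γ₄) ∧ ∀ φ, IsTest φ →
        variation S k v (normalCoeff S v v₁ v₃) (traceCoeff S k K u₀ u v₁ v₂ v₃) φ = 0 := by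
  constructor
  · rintro ⟨v₁, v₂, v₃, h₁, h₂, h₃, h⟩
    refine ⟨v₁, v₂, v₃, h₁, h₂, h₃, fun φ hφ => ?_⟩
    have hre : ∀ φ, IsTest φ → (variation S k v (normalCoeff S v v₁ v₃)
        (traceCoeff S k K u₀ u v₁ v₂ v₃) φ).re = 0 := fun φ hφ =>
      (hasDerivAt_lagrangian hu₀ hu hv h₁ h₂ h₃ hφ.1).unique (h φ hφ)
    have hI := hre (fun x => Complex.I * φ x) ⟨contDiff_const.mul hφ.1, hφ.2.mul_left⟩
    rw [variation_const_mul _ hφ.1, Complex.I_mul_re, neg_eq_zero] at hI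
    exact Complex.ext (hre φ hφ) hI
  · rintro ⟨v₁, v₂, v₃, h₁, h₂, h₃, h⟩
    refine ⟨v₁, v₂, v₃, h₁, h₂, h₃, fun φ hφ => ?_⟩
    have := hasDerivAt_lagrangian hu₀ hu hv h₁ h₂ h₃ hφ.1
    rwa [h φ hφ, Complex.zero_re] at this

theorem isTest_conj {φ : Plane → ℂ} (hφ : IsTest φ) : IsTest fun x => conj (φ x) :=
  ⟨Complex.conjCLE.contDiff.comp hφ.1, hφ.2.comp_left (map_zero _)⟩

theorem pderiv_conj {φ : Plane → ℂ} (hφ : ContDiff ℝ ∞ φ) (i : Fin 2) (x : Plane) :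
    pderiv i (fun x => conj (φ x)) x = conj (pderiv i φ x) := by
  have h := Complex.conjCLE.toContinuousLinearMap.hasFDerivAt.comp x
    (hφ.differentiable (by simp) x).hasFDerivAt
  have e : fderiv ℝ (fun x => conj (φ x)) x = _ := h.fderiv
  simp [pderiv, e]

/-- If the coefficient of the normal derivative vanishes, the variation is the defect in Green's
formula. -/
theorem variation_conj_eq (hv : S.MemH1 v) {b q φ : Plane → ℂ}
    (hb : ∀ᵐ x ∂(arcLength S.Γ), b x = 0) (hφ : IsTest φ) :
    variation S k v b q (fun x => conj (φ x)) = conj ((∫ x in S.Ω, ∑ i, v.grad i x * pderiv i φ x)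
      + (∫ x in S.Ω, -((k : ℂ) ^ 2 * v.fn x) * φ x) + ∫ x, q x * φ x ∂(arcLength S.Γ)) := by
  have e1 : ∀ (μ : Measure Plane) (f g : Plane → ℂ),
      pairing μ (fun x => conj (f x)) g = conj (∫ x, g x * f x ∂μ) := fun μ f g => by
    simp only [pairing, ← integral_conj, map_mul, mul_comm]
  have e2 : pairing (arcLength S.Γ) (S.dn fun x => conj (φ x)) b = 0 :=
    integral_eq_zero_of_ae (hb.mono fun x hx => by simp [hx])
  have e3 : ∀ i, pderiv i (fun x => conj (φ x)) = fun x => conj (pderiv i φ x) := fun i =>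
    funext (pderiv_conj hφ.1 i)
  have e4 : ∫ x in S.Ω, ∑ i, v.grad i x * pderiv i φ x
      = ∑ i, ∫ x in S.Ω, v.grad i x * pderiv i φ x :=
    integral_finsetSum _ fun i _ =>
      (hv.1.2.1 i).integrable_mul (S.memLp_Ω_of_continuous (continuous_pderiv hφ.1 i))
  have e5 : ∫ x in S.Ω, -((k : ℂ) ^ 2 * v.fn x) * φ x
      = -((k : ℂ) ^ 2 * ∫ x in S.Ω, v.fn x * φ x) := by
    simp only [neg_mul, mul_assoc, integral_neg, integral_const_mul]
  simp only [variation, e2, e3, e1, e4, e5, map_add, map_neg, map_mul, map_sum, map_pow,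
    Complex.conj_ofReal]
  ring

/-! ### The coefficients on the parts of the boundary -/

theorem ae_arcLength_notMem {A B : Set Plane} (hA : MeasurableSet A)
    (h : AEDisjoint (Measure.hausdorffMeasure 1) A B) : ∀ᵐ x ∂(arcLength A), x ∉ B := by
  rw [arcLength, ae_restrict_iff' hA]
  refine measure_mono_null (fun x hx => ?_) h
  simpa using hx

theorem Configuration.notMem_Γ₅ (S : Configuration) {x : Plane}
    (hx : x ∈ S.Γ₁ ∪ S.Γ₂ ∪ S.Γ₃ ∪ S.Γ₄) : x ∉ S.Γ₅ := fun h => by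
  rw [S.union_eq, S.isOpen_tank.frontier_eq] at hx
  exact hx.2 (S.frontier_obstacle_subset h)

theorem ae_coeff_Γ₁ (S : Configuration) : ∀ᵐ x ∂(arcLength S.Γ₁),
    normalCoeff S v v₁ v₃ x = v.trace x + v₁ x ∧
    traceCoeff S k K u₀ u v₁ v₂ v₃ x = (u.trace x - u₀ x) + k * alpha K * v₁ x := by
  filter_upwards [ae_restrict_mem S.measurable₁, ae_arcLength_notMem S.measurable₁ S.disjoint₁₂,
    ae_arcLength_notMem S.measurable₁ S.disjoint₁₃,
    ae_arcLength_notMem S.measurable₁ S.disjoint₁₄] with x h1 h2 h3 h4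
  simp [normalCoeff, traceCoeff, h1, h2, h3, h4]

theorem ae_coeff_Γ₂ (S : Configuration) : ∀ᵐ x ∂(arcLength S.Γ₂),
    normalCoeff S v v₁ v₃ x = v.trace x ∧ traceCoeff S k K u₀ u v₁ v₂ v₃ x = v₂ x := by
  filter_upwards [ae_restrict_mem S.measurable₂,
    ae_arcLength_notMem S.measurable₂ S.disjoint₁₂.symm,
    ae_arcLength_notMem S.measurable₂ S.disjoint₂₃,
    ae_arcLength_notMem S.measurable₂ S.disjoint₂₄] with x h2 h1 h3 h4
  have h5 : x ∉ S.Γ₅ := S.notMem_Γ₅ (Or.inl (Or.inl (Or.inr h2)))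
  simp [normalCoeff, traceCoeff, h1, h2, h3, h4, h5]

theorem ae_coeff_Γ₃ (S : Configuration) : ∀ᵐ x ∂(arcLength S.Γ₃),
    normalCoeff S v v₁ v₃ x = v.trace x ∧ traceCoeff S k K u₀ u v₁ v₂ v₃ x = v₂ x := by
  filter_upwards [ae_restrict_mem S.measurable₃,
    ae_arcLength_notMem S.measurable₃ S.disjoint₁₃.symm,
    ae_arcLength_notMem S.measurable₃ S.disjoint₂₃.symm,
    ae_arcLength_notMem S.measurable₃ S.disjoint₃₄] with x h3 h1 h2 h4
  have h5 : x ∉ S.Γ₅ := S.notMem_Γ₅ (Or.inl (Or.inr h3))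
  simp [normalCoeff, traceCoeff, h1, h2, h3, h4, h5]

theorem ae_coeff_Γ₄ (S : Configuration) : ∀ᵐ x ∂(arcLength S.Γ₄),
    normalCoeff S v v₁ v₃ x = v.trace x + v₃ x ∧
    traceCoeff S k K u₀ u v₁ v₂ v₃ x = -(Complex.I * k) * v₃ x := by
  filter_upwards [ae_restrict_mem S.measurable₄,
    ae_arcLength_notMem S.measurable₄ S.disjoint₁₄.symm,
    ae_arcLength_notMem S.measurable₄ S.disjoint₂₄.symm,
    ae_arcLength_notMem S.measurable₄ S.disjoint₃₄.symm] with x h4 h1 h2 h3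
  have h5 : x ∉ S.Γ₅ := S.notMem_Γ₅ (Or.inr h4)
  simp [normalCoeff, traceCoeff, h1, h2, h3, h4, h5]

theorem ae_coeff_Γ₅ (S : Configuration) : ∀ᵐ x ∂(arcLength S.Γ₅),
    normalCoeff S v v₁ v₃ x = v.trace x + v₁ x ∧
    traceCoeff S k K u₀ u v₁ v₂ v₃ x = k * alpha K * v₁ x := by
  filter_upwards [ae_restrict_mem S.measurable₅] with x h5
  have h : x ∉ S.Γ₁ ∪ S.Γ₂ ∪ S.Γ₃ ∪ S.Γ₄ := fun hx => S.notMem_Γ₅ hx h5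
  simp only [Set.mem_union, not_or] at h
  obtain ⟨⟨⟨h1, h2⟩, h3⟩, h4⟩ := h
  simp [normalCoeff, traceCoeff, h1, h2, h3, h4, h5]

theorem ae_arcLength_Γ_iff {P : Plane → Prop} : (∀ᵐ x ∂(arcLength S.Γ), P x) ↔
    (∀ᵐ x ∂(arcLength S.Γ₁), P x) ∧ (∀ᵐ x ∂(arcLength S.Γ₂), P x) ∧
    (∀ᵐ x ∂(arcLength S.Γ₃), P x) ∧ (∀ᵐ x ∂(arcLength S.Γ₄), P x) ∧
    (∀ᵐ x ∂(arcLength S.Γ₅), P x) := by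
  simp only [arcLength, Configuration.Γ, ae_restrict_union_iff, and_assoc]

theorem integral_arcLength_Γ_eq_zero {f φ : Plane → ℂ} (hφ : tsupport φ ⊆ S.Ω) :
    ∫ x, f x * φ x ∂(arcLength S.Γ) = 0 := by
  refine integral_eq_zero_of_ae ?_
  filter_upwards [ae_restrict_mem S.measurableSet_Γ] with x hx
  have : φ x = 0 := image_eq_zero_of_notMem_tsupport fun hm =>
    Set.disjoint_left.1 S.disjoint_Γ_Ω hx (hφ hm)
  simp [this]

/-! ### The two implications -/

theorem IsAdjoint.solvesAdjointProblem (hu₀ : MemLp u₀ 2 (arcLength S.Γ₁))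
    (hu : IsStateSolution S k A θ K u) (hv : S.MemH1 v) (h : IsAdjoint S k A θ K u₀ u v) :
    SolvesAdjointProblem S k K u₀ u v := by
  obtain ⟨v₁, v₂, v₃, h₁, h₂, h₃, h⟩ := (isAdjoint_iff_variation hu₀ hu hv).1 h
  set b := normalCoeff S v v₁ v₃ with hbdef
  set q := traceCoeff S k K u₀ u v₁ v₂ v₃ with hqdef
  have hbL : MemLp b 2 (arcLength S.Γ) := memLp_normalCoeff hv.2.1 h₁ h₃
  have hqL : MemLp q 2 (arcLength S.Γ) := memLp_traceCoeff hu₀ hu.memH1.2.1 h₁ h₂ h₃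
  have hb : ∀ᵐ x ∂(arcLength S.Γ), b x = 0 := by
    have := S.normal_coeff_eq_zero (F := fun x => -(k : ℂ) ^ 2 * conj (v.fn x))
      (G := fun i x => conj (v.grad i x)) (Q := fun x => conj (q x)) (B := fun x => -conj (b x))
      (((memLp_conj hv.1.1).integrable one_le_two).const_mul _)
      (fun i => (memLp_conj (hv.1.2.1 i)).integrable one_le_two)
      ((memLp_conj hqL).integrable one_le_two)
      ((memLp_conj hbL).integrable one_le_two).neg fun φ hφ => by
        rw [← h φ hφ]
        simp only [variation, pairing, mul_neg, integral_neg, neg_mul,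
          mul_left_comm _ ((k : ℂ) ^ 2), integral_const_mul, ← sub_eq_add_neg]
    filter_upwards [this] with x hx
    simpa using hx
  have green : ∀ φ, IsTest φ → (∫ x in S.Ω, ∑ i, v.grad i x * pderiv i φ x)
      + (∫ x in S.Ω, -((k : ℂ) ^ 2 * v.fn x) * φ x) + ∫ x, q x * φ x ∂(arcLength S.Γ) = 0 :=
    fun φ hφ => by
      have := variation_conj_eq (k := k) (q := q) hv hb hφ
      rw [h _ (isTest_conj hφ)] at this
      exact (map_eq_zero _).1 this.symm
  have hL : MemLp (fun x => -((k : ℂ) ^ 2 * v.fn x)) 2 (volume.restrict S.Ω) :=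
    (hv.1.1.const_mul _).neg
  obtain ⟨b1, b2, b3, b4, b5⟩ := ae_arcLength_Γ_iff.1 hb
  refine ⟨⟨hL, fun φ hφ hs => ?_⟩, fun x => -q x, ⟨hqL.neg, fun φ hφ => ?_⟩, ?_, ?_, ?_, ?_⟩
  · have := green φ hφ
    rw [integral_arcLength_Γ_eq_zero hs, add_zero] at this
    exact eq_neg_of_add_eq_zero_left this
  · simp only [neg_mul (q _), integral_neg]
    exact eq_neg_of_add_eq_zero_left (green φ hφ)
  · filter_upwards [b1, ae_coeff_Γ₁ (v := v) (v₁ := v₁) (v₂ := v₂) (v₃ := v₃) (u := u) (u₀ := u₀)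
      (k := k) (K := K) S] with x h0 hx
    rw [hqdef, hx.2]
    rw [hbdef, hx.1] at h0
    linear_combination -(k * alpha K) * h0
  · filter_upwards [b5, ae_coeff_Γ₅ (v := v) (v₁ := v₁) (v₂ := v₂) (v₃ := v₃) (u := u) (u₀ := u₀)
      (k := k) (K := K) S] with x h0 hx
    rw [hqdef, hx.2]
    rw [hbdef, hx.1] at h0
    linear_combination -(k * alpha K) * h0
  · filter_upwards [b4, ae_coeff_Γ₄ (v := v) (v₁ := v₁) (v₂ := v₂) (v₃ := v₃) (u := u) (u₀ := u₀)
      (k := k) (K := K) S] with x h0 hx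
    rw [hqdef, hx.2]
    rw [hbdef, hx.1] at h0
    linear_combination (Complex.I * k) * h0
  · refine (ae_restrict_union_iff _ _ _).2 ⟨?_, ?_⟩
    · filter_upwards [b2, ae_coeff_Γ₂ (v := v) (v₁ := v₁) (v₂ := v₂) (v₃ := v₃) (u := u)
        (u₀ := u₀) (k := k) (K := K) S] with x h0 hx
      rw [← hx.1]; exact h0
    · filter_upwards [b3, ae_coeff_Γ₃ (v := v) (v₁ := v₁) (v₂ := v₂) (v₃ := v₃) (u := u)
        (u₀ := u₀) (k := k) (K := K) S] with x h0 hx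
      rw [← hx.1]; exact h0

theorem SolvesAdjointProblem.isAdjoint (hu₀ : MemLp u₀ 2 (arcLength S.Γ₁))
    (hu : IsStateSolution S k A θ K u) (hv : S.MemH1 v) (h : SolvesAdjointProblem S k K u₀ u v) :
    IsAdjoint S k A θ K u₀ u v := by
  obtain ⟨-, d, hd, d1, d5, d4, d23⟩ := h
  have hvt : MemLp (fun x => -v.trace x) 2 (arcLength S.Γ) := MemLp.neg hv.2.1
  refine (isAdjoint_iff_variation hu₀ hu hv).2 ⟨fun x => -v.trace x, fun x => -d x,
    fun x => -v.trace x, memLp_arcLength_mono S.Γ₁_union_Γ₅_subset hvt,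
    memLp_arcLength_mono (Set.union_subset S.Γ₂_subset S.Γ₃_subset) hd.1.neg,
    memLp_arcLength_mono S.Γ₄_subset hvt, fun φ hφ => ?_⟩
  obtain ⟨t2, t3⟩ := (ae_restrict_union_iff _ _ _).1 d23
  have hcoeff : ∀ᵐ x ∂(arcLength S.Γ),
      normalCoeff S v (fun x => -v.trace x) (fun x => -v.trace x) x = 0 ∧
      traceCoeff S k K u₀ u (fun x => -v.trace x) (fun x => -d x) (fun x => -v.trace x) x
        = -d x := by
    refine ae_arcLength_Γ_iff.2 ⟨?_, ?_, ?_, ?_, ?_⟩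
    · filter_upwards [d1, ae_coeff_Γ₁ S] with x h0 hx
      rw [hx.1, hx.2, h0]
      exact ⟨by ring, by ring⟩
    · filter_upwards [t2, ae_coeff_Γ₂ S] with x h0 hx
      rw [hx.1, hx.2]
      exact ⟨h0, rfl⟩
    · filter_upwards [t3, ae_coeff_Γ₃ S] with x h0 hx
      rw [hx.1, hx.2]
      exact ⟨h0, rfl⟩
    · filter_upwards [d4, ae_coeff_Γ₄ S] with x h0 hx
      rw [hx.1, hx.2, h0]
      exact ⟨by ring, by ring⟩
    · filter_upwards [d5, ae_coeff_Γ₅ S] with x h0 hx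
      rw [hx.1, hx.2, h0]
      exact ⟨by ring, by ring⟩
  have hg := variation_conj_eq (k := k) (q := traceCoeff S k K u₀ u (fun x => -v.trace x)
    (fun x => -d x) (fun x => -v.trace x)) hv (hcoeff.mono fun x hx => hx.1) (isTest_conj hφ)
  simp only [Complex.conj_conj] at hg
  rw [hg, map_eq_zero, hd.2 _ (isTest_conj hφ), ← eq_neg_iff_add_eq_zero, ← integral_neg]
  refine integral_congr_ae (hcoeff.mono fun x hx => ?_)
  simp only [hx.2, neg_mul, neg_neg]

end

end Helmholtz

end

theorem mainTheorem1 (S : Helmholtz.Configuration) (k A θ K : ℝ) (hk : 0 < k) (hA : 0 < A)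
    (hK : K ≠ -1) (u₀ : Helmholtz.Plane → ℂ)
    (hu₀ : MeasureTheory.MemLp u₀ 2 (Helmholtz.arcLength S.Γ₁))
    (u : Helmholtz.CauchyField) (hu : Helmholtz.IsStateSolution S k A θ K u)
    (v : Helmholtz.TracedField) (hv : S.MemH1 v) :
    Helmholtz.IsAdjoint S k A θ K u₀ u v ↔ Helmholtz.SolvesAdjointProblem S k K u₀ u v :=
  ⟨fun h => h.solvesAdjointProblem hu₀ hu hv, fun h => h.isAdjoint hu₀ hu hv⟩
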